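/- Let $p$ be a prime and let $\mathcal O$ be either a discrete valuation ring or a field, with maximal ideal $\mathfrak m$ and residue field $k=\mathcal O/\mathfrak m$ of characteristic $p$ (so $k=\mathcal O$ is allowed); nothing is assumed about the size of $\mathcal O$ and $k$. Let $K$ be a normal subgroup of a finite group $H$, and put $G=H/K$. Let $b$ be a block of $\mathcal OK$ (a primitive idempotent of $Z(\mathcal OK)$) with defect group $P$, i.e. $P$ is a $p$-subgroup of $K$ with $b\in(\mathcal OK)^K_P$ (the image of the relative trace $\mathrm{Tr}_P^K:(\mathcal OK)^P\to(\mathcal OK)^K$) and $\mathrm{Br}_P(b)\ne 0$, where $\mathrm{Br}_P:(\mathcal OH)^P\to kC_H(P)$, $\sum_h a_h h\mapsto\sum_{h\in C_H(P)}\bar a_h h$, is the Brauer homomorphism. Assume that $\mathcal O$ is $\mathfrak m$-adically complete or, more generally, that the commutative ring $b\,Z(\mathcal OK)$ is local (which is automatic if $\mathcal O$ is complete). Let $b_1$ be the Brauer correspondent of $b$: the block of $\mathcal ON_K(P)$ with defect group $P$ such that $\mathrm{Br}_P(b_1)=\mathrm{Br}_P(b)$. Put $\bar b=\mathrm{Br}_P(b)=\mathrm{Br}_P(b_1)\in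 kC_H(P)$. A subscript $b$, $b_1$ or $\bar b$ on a group denotes the stabilizer under conjugation. For a subgroup $L\le H$ identify $L/(L\cap K)$ with $LK/K\le G$; for $R\in\{\mathcal O,k\}$ and $\sigma\in G$ let $(RL)_\sigma$ be the $R$-span of $\sigma\cap L$. Consider three cases: (1') $R=\mathcal O$, $L=H$, $F=K$, $e=b$; (2') $R=\mathcal O$, $L=N_H(P)$, $F=N_K(P)$, $e=b_1$; (3') $R=k$, $L=C_H(P)$, $F=N_K(P)$, $e=\bar b$. In each case put $C_\sigma=e\,(RL)_\sigma^F$ (with $F$ acting by conjugation) and $$\Gamma=\{\sigma\in L_eK/K\mid C_\sigma C_{\sigma^{-1}}=C_1\},\qquad C=\bigoplus_{\sigma\in\Gamma}C_\sigma,\qquad \bar C=C/CJ(C_1),\qquad \bar C_1=C_1/J(C_1).$$ The group $\Gamma$ is denoted $G[b]$ in case (1'), $G[b_1]$ in case (2') and $\overline{C_H(P)}[\bar b]$ in case (3'). The Clifford extension of $e$ is $$1\to\bar C_1^{*}\to \mathrm{hU}(\bar C)\to\Gamma\to1,$$ where $\mathrm{hU}(\bar C)$ is the group of homogeneous units of the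 $\Gamma$-graded ring $\bar C$ and the second map is the degree. Moreover, for a set $S\subseteq G$ let $\Gamma_S$ be the set of all $\sigma\in S$ with $\bar b(kC_H(P))_\sigma^{N_K(P)}\cdot\bar b(kC_H(P))_{\sigma^{-1}}^{N_K(P)}=\bar b(kC_H(P))_1^{N_K(P)}$, and put $G[\bar b]=\Gamma_{G_b}$, where $G_b=H_bK/K$, $\overline{N_H(P)_b}[\bar b]=\Gamma_{N_H(P)_bK/K}$ and $\overline{C_H(P)_b}[\bar b]=\Gamma_{C_H(P)_bK/K}$. Then the following hold. (a) $N_H(P)_b=N_H(P)_{b_1}=N_H(P)_{\bar b}$. (b) As subsets of $G$, $$G[b]=G[b_1]=\overline{C_H(P)}[\bar b]=G[\bar b]=\overline{N_H(P)_b}[\bar b]=\overline{C_H(P)_b}[\bar b].$$ (c) In each of the three cases the sequence above is exact, and the extensions (1'), (2') and (3') are pairwise isomorphic, compatibly with the identity of $G[b]$ and with the conjugation action of $N_H(P)_b$: between any two of the three rings $\bar C$ there is an isomorphism which is $\mathcal O$-linear (where $\mathcal O$ acts in case (3') through $\mathcal O\to k$), maps the component of each degree $\sigma\in G[b]$ onto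 the component of degree $\sigma$, and commutes with the action of $N_H(P)_b$; its restriction to the homogeneous units is an isomorphism of the extensions. -/

import Mathlib

noncomputable section

namespace BlockClifford

variable {H : Type*} [Group H]

/-! ### Elements of a group algebra `RH`: conjugation, supports, fixed points -/

/-- Conjugation `a ↦ g a g⁻¹` on the group algebra `RH`. -/
def conj (R : Type*) [CommRing R] (g : H) : MonoidAlgebra R H ≃ₐ[R] MonoidAlgebra R H :=
  MonoidAlgebra.domCongr R R (MulAut.conj g)

theorem coeff_conj (R : Type*) [CommRing R] (g : H) (a : MonoidAlgebra R H) (h : H) :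
    (conj R g a).coeff h = a.coeff (g⁻¹ * h * g) := by
  simp [conj]

theorem conj_one (R : Type*) [CommRing R] (a : MonoidAlgebra R H) : conj R 1 a = a := by
  ext h; simp [coeff_conj]

theorem conj_mul (R : Type*) [CommRing R] (g h : H) (a : MonoidAlgebra R H) :
    conj R (g * h) a = conj R g (conj R h a) := by
  ext x; simp [coeff_conj, mul_assoc]

theorem conj_inv_conj (R : Type*) [CommRing R] (g : H) (a : MonoidAlgebra R H) :
    conj R g⁻¹ (conj R g a) = a := by
  rw [← conj_mul, inv_mul_cancel, conj_one]

theorem conj_conj_inv (R : Type*) [CommRing R] (g : H) (a : MonoidAlgebra R H) :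
    conj R g (conj R g⁻¹ a) = a := by
  rw [← conj_mul, mul_inv_cancel, conj_one]

theorem single_mul_eq (R : Type*) [CommRing R] (g : H) (r : R) (a : MonoidAlgebra R H) :
    MonoidAlgebra.single g r * a = conj R g a * MonoidAlgebra.single g r := by
  ext h
  simp [coeff_conj, mul_comm, mul_assoc]

/-- `a` lies in `RL`, the group algebra of the subgroup `L`, seen inside `RH`. -/
def SupportedOn {R : Type*} [CommRing R] (L : Subgroup H) (a : MonoidAlgebra R H) : Prop :=
  ∀ h, a.coeff h ≠ 0 → h ∈ L

/-- `a` is fixed by conjugation with every element of `F`. -/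
def FixedBy {R : Type*} [CommRing R] (F : Subgroup H) (a : MonoidAlgebra R H) : Prop :=
  ∀ g ∈ F, conj R g a = a

theorem exists_coeff_ne_zero_of_mul {R : Type*} [CommRing R] {a c : MonoidAlgebra R H} {h : H}
    (hh : (a * c).coeff h ≠ 0) : ∃ x y, a.coeff x ≠ 0 ∧ c.coeff y ≠ 0 ∧ x * y = h := by
  classical
  by_contra hcon
  push Not at hcon
  apply hh
  rw [MonoidAlgebra.coeff_mul]
  refine Finset.sum_eq_zero fun x hx => Finset.sum_eq_zero fun y hy => ?_
  show (if x * y = h then _ else _) = _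
  rw [if_neg (hcon x y (Finsupp.mem_support_iff.mp hx) (Finsupp.mem_support_iff.mp hy))]

theorem SupportedOn.mul {R : Type*} [CommRing R] {L : Subgroup H} {a c : MonoidAlgebra R H}
    (ha : SupportedOn L a) (hc : SupportedOn L c) : SupportedOn L (a * c) := fun h hh => by
  obtain ⟨x, y, hx, hy, rfl⟩ := exists_coeff_ne_zero_of_mul hh
  exact L.mul_mem (ha x hx) (hc y hy)

theorem FixedBy.mul {R : Type*} [CommRing R] {F : Subgroup H} {a c : MonoidAlgebra R H}
    (ha : FixedBy F a) (hc : FixedBy F c) : FixedBy F (a * c) := fun g hg => by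
  rw [map_mul, ha g hg, hc g hg]

/-- An element of `RF` commutes with every element fixed by `F`. -/
theorem SupportedOn.commute {R : Type*} [CommRing R] {F : Subgroup H} {a c : MonoidAlgebra R H}
    (ha : SupportedOn F a) (hc : FixedBy F c) : a * c = c * a := by
  classical
  have key : a = a.coeff.support.sum fun h => MonoidAlgebra.single h (a.coeff h) := by
    ext x
    simp only [MonoidAlgebra.coeff_sum, MonoidAlgebra.coeff_single, Finsupp.finsetSum_apply,
      Finsupp.single_apply]
    simp +contextual [eq_comm]
  rw [key, Finset.sum_mul, Finset.mul_sum]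
  refine Finset.sum_congr rfl fun h hh => ?_
  rw [single_mul_eq, hc h (ha h (Finsupp.mem_support_iff.mp hh))]

/-- The stabilizer `L_e` of `e` in `L` under conjugation. -/
def stab {R : Type*} [CommRing R] (L : Subgroup H) (e : MonoidAlgebra R H) : Subgroup H where
  carrier := {h | h ∈ L ∧ conj R h e = e}
  one_mem' := ⟨L.one_mem, conj_one R e⟩
  mul_mem' := fun {a b} ha hb => ⟨L.mul_mem ha.1 hb.1, by rw [conj_mul, hb.2, ha.2]⟩
  inv_mem' := fun {a} ha => ⟨L.inv_mem ha.1, by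
    conv_lhs => rw [← ha.2]
    exact conj_inv_conj R a e⟩

/-! ### Blocks, the Brauer homomorphism, defect groups -/

/-- `e` is a block of `RM`: a primitive idempotent of the centre of `RM`. -/
structure IsBlock {R : Type*} [CommRing R] (M : Subgroup H) (e : MonoidAlgebra R H) : Prop where
  supported : SupportedOn M e
  central : ∀ a, SupportedOn M a → e * a = a * e
  idem : e * e = e
  ne_zero : e ≠ 0
  primitive : ∀ f : MonoidAlgebra R H, SupportedOn M f →
    (∀ a, SupportedOn M a → f * a = a * f) → f * f = f → e * f = f → f = 0 ∨ f = e

theorem supportedOn_single {R : Type*} [CommRing R] {M : Subgroup H} {g : H} (hg : g ∈ M) (r : R) :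
    SupportedOn M (MonoidAlgebra.single g r) := by
  classical
  intro h hh
  rw [MonoidAlgebra.coeff_single, Finsupp.single_apply] at hh
  by_cases hgh : g = h
  · exact hgh ▸ hg
  · simp [hgh] at hh

theorem IsBlock.fixedBy {R : Type*} [CommRing R] {M : Subgroup H} {e : MonoidAlgebra R H}
    (he : IsBlock M e) : FixedBy M e := fun g hg => by
  have h1 := he.central _ (supportedOn_single hg (1 : R))
  rw [single_mul_eq] at h1
  have h2 := congrArg (· * MonoidAlgebra.single g⁻¹ (1 : R)) h1
  simpa [mul_assoc, MonoidAlgebra.single_mul_single, ← MonoidAlgebra.one_def] using h2.symm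

/-- The relative trace `Tr_P^M(a) = ∑_{m ∈ M/P} m a m⁻¹`. -/
def relTrace [Finite H] {R : Type*} [CommRing R] (P M : Subgroup H) (a : MonoidAlgebra R H) :
    MonoidAlgebra R H :=
  ∑ᶠ q : M ⧸ P.subgroupOf M, conj R ((Quotient.out q : M) : H) a

section Brauer

variable (O : Type*) [CommRing O] [IsLocalRing O]

open scoped Classical in
/-- The Brauer homomorphism `Br_P : (OH)^P → kC_H(P)`, `∑ aₕ h ↦ ∑_{h ∈ C_H(P)} āₕ h`, where `k` is
the residue field of `O`; it is written down as an additive map on the whole of `OH`. -/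
def brauerMap (P : Subgroup H) :
    MonoidAlgebra O H →+ MonoidAlgebra (IsLocalRing.ResidueField O) H where
  toFun a := MonoidAlgebra.ofCoeff
    (((MonoidAlgebra.mapRingHom H (IsLocalRing.residue O)) a).coeff.filter
      (· ∈ Subgroup.centralizer (P : Set H)))
  map_zero' := by ext h; simp [Finsupp.filter_apply]
  map_add' a c := by ext h; simp [Finsupp.filter_add]

end Brauer

/-- The subgroup `N_K(P)` of `H`. -/
abbrev normIn (K P : Subgroup H) : Subgroup H := Subgroup.normalizer (P : Set H) ⊓ K

/-- The `p`-subgroup `P` of `M` is a defect group of the block `b` of `OM`: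
`b ∈ (OM)_P^M` and `Br_P(b) ≠ 0`. -/
structure IsDefectGroup [Finite H] (p : ℕ) {O : Type*} [CommRing O] [IsLocalRing O]
    (M P : Subgroup H) (b : MonoidAlgebra O H) : Prop where
  le : P ≤ M
  isPGroup : IsPGroup p P
  mem_trace : ∃ a : MonoidAlgebra O H, SupportedOn M a ∧ FixedBy P a ∧ relTrace P M a = b
  brauer_ne_zero : brauerMap O P b ≠ 0

/-- `b₁` is the Brauer correspondent of the block `b` of `OK` with defect group `P`: it is a block
of `ON_K(P)` with defect group `P`, and `Br_P(b₁) = Br_P(b)`. -/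
structure IsBrauerCorrespondent [Finite H] (p : ℕ) {O : Type*} [CommRing O] [IsLocalRing O]
    (K P : Subgroup H) (b b₁ : MonoidAlgebra O H) : Prop where
  isBlock : IsBlock (normIn K P) b₁
  isDefectGroup : IsDefectGroup p (normIn K P) P b₁
  brauer_eq : brauerMap O P b₁ = brauerMap O P b

/-! ### The graded algebras and the stabilizers `G[e]` -/

section Components

variable {R : Type*} [CommRing R] (K : Subgroup H) [K.Normal]

/-- For `σ ∈ G = H/K`, the `F`-fixed part `(RL)_σ^F` of the component `(RL)_σ = R(L ∩ σ)` of the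
group algebra `RL`. This is the grading of `RL` by `L/(L ∩ K)`, a group which is identified with the
subgroup `LK/K` of `H/K`. -/
def fixedComp (L F : Subgroup H) (σ : H ⧸ K) : Submodule R (MonoidAlgebra R H) where
  carrier := {x | (∀ h, x.coeff h ≠ 0 → h ∈ L ∧ (h : H ⧸ K) = σ) ∧ FixedBy F x}
  zero_mem' := ⟨fun h hh => absurd (by simp) hh, fun g _ => map_zero _⟩
  add_mem' := fun {x y} hx hy => ⟨fun h hh => by
      by_cases h0 : x.coeff h = 0
      · exact hy.1 h fun h1 => hh (by simp [h0, h1])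
      · exact hx.1 h h0,
    fun g hg => by rw [map_add, hx.2 g hg, hy.2 g hg]⟩
  smul_mem' := fun r x hx => ⟨fun h hh => hx.1 h fun h1 => hh (by simp [h1]),
    fun g hg => by rw [map_smul, hx.2 g hg]⟩

/-- The component `e (RL)_σ^F`. -/
def eComp (L F : Subgroup H) (e : MonoidAlgebra R H) (σ : H ⧸ K) :
    Submodule R (MonoidAlgebra R H) :=
  (fixedComp K L F σ).map (LinearMap.mulLeft R e)

/-- The set of all `σ ∈ SK/K` with `e(RL)_σ^F · e(RL)_{σ⁻¹}^F = e(RL)_1^F`. -/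
def cliffordSet (S L F : Subgroup H) (e : MonoidAlgebra R H) : Set (H ⧸ K) :=
  {σ | σ ∈ S.map (QuotientGroup.mk' K) ∧
    eComp K L F e σ * eComp K L F e σ⁻¹ = eComp K L F e 1}

end Components

/-- The input of the construction of a Clifford extension: the group algebra `RL` graded by
`L/(L ∩ K) ≃ LK/K`, a group `F` containing `L ∩ K` whose fixed points are taken, and an idempotent
`e` of `(R(L ∩ K))^F`. -/
structure Datum (R : Type*) [CommRing R] (K : Subgroup H) where
  L : Subgroup H
  F : Subgroup H
  e : MonoidAlgebra R H
  le : L ⊓ K ≤ F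
  supported : SupportedOn (L ⊓ K) e
  fixed : FixedBy F e
  idem : e * e = e

namespace Datum

variable {R : Type*} [CommRing R] {K : Subgroup H} [K.Normal]

/-- The component `C_σ = e (RL)_σ^F`. -/
abbrev comp (D : Datum R K) (σ : H ⧸ K) : Submodule R (MonoidAlgebra R H) :=
  eComp K D.L D.F D.e σ



theorem mem_comp (D : Datum R K) {σ : H ⧸ K} {x : MonoidAlgebra R H} :
    x ∈ D.comp σ ↔
      (∀ h, x.coeff h ≠ 0 → h ∈ D.L ∧ (h : H ⧸ K) = σ) ∧ FixedBy D.F x ∧ D.e * x = x := by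
  constructor
  · rintro ⟨y, hy, rfl⟩
    refine ⟨fun h hh => ?_, D.fixed.mul hy.2, ?_⟩
    · obtain ⟨u, v, hu, hv, rfl⟩ := exists_coeff_ne_zero_of_mul hh
      have h1 := D.supported u hu
      have h2 := hy.1 v hv
      refine ⟨D.L.mul_mem h1.1 h2.1, ?_⟩
      rw [QuotientGroup.mk_mul, h2.2, (QuotientGroup.eq_one_iff u).mpr h1.2, one_mul]
    · simp [← mul_assoc, D.idem]
  · rintro ⟨h1, h2, h3⟩
    exact ⟨x, ⟨h1, h2⟩, h3⟩

theorem e_mem (D : Datum R K) : D.e ∈ D.comp 1 :=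
  D.mem_comp.mpr ⟨fun h hh => ⟨(D.supported h hh).1,
    (QuotientGroup.eq_one_iff h).mpr (D.supported h hh).2⟩, D.fixed, D.idem⟩

theorem e_comm (D : Datum R K) {x : MonoidAlgebra R H} (hx : FixedBy D.F x) :
    D.e * x = x * D.e :=
  SupportedOn.commute (fun h hh => D.le (D.supported h hh)) hx

theorem mul_mem_comp (D : Datum R K) {σ τ : H ⧸ K} {x y : MonoidAlgebra R H}
    (hx : x ∈ D.comp σ) (hy : y ∈ D.comp τ) : x * y ∈ D.comp (σ * τ) := by
  rw [mem_comp] at *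
  refine ⟨fun h hh => ?_, hx.2.1.mul hy.2.1, by rw [← mul_assoc, hx.2.2]⟩
  obtain ⟨u, v, hu, hv, rfl⟩ := exists_coeff_ne_zero_of_mul hh
  refine ⟨D.L.mul_mem (hx.1 u hu).1 (hy.1 v hv).1, ?_⟩
  rw [QuotientGroup.mk_mul, (hx.1 u hu).2, (hy.1 v hv).2]

theorem comp_mul_le (D : Datum R K) (σ τ : H ⧸ K) : D.comp σ * D.comp τ ≤ D.comp (σ * τ) :=
  Submodule.mul_le.mpr fun _ hx _ hy => D.mul_mem_comp hx hy

theorem one_mul_comp (D : Datum R K) (σ : H ⧸ K) : D.comp 1 * D.comp σ = D.comp σ := by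
  refine le_antisymm (by simpa using D.comp_mul_le 1 σ) fun x hx => ?_
  rw [← (D.mem_comp.mp hx).2.2]
  exact Submodule.mul_mem_mul D.e_mem hx

/-- The group `G[e]` of all `σ` in `L_eK/K ≃ L_e/(L ∩ K)` with `C_σ C_{σ⁻¹} = C_1`. -/
def group [Finite H] (D : Datum R K) : Subgroup (H ⧸ K) :=
  let M : Submonoid (H ⧸ K) :=
    { carrier := cliffordSet K (stab D.L D.e) D.L D.F D.e
      one_mem' := ⟨one_mem _, by rw [inv_one]; exact D.one_mul_comp 1⟩
      mul_mem' := fun {σ τ} hσ hτ => ⟨mul_mem hσ.1 hτ.1, by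
        refine le_antisymm (by simpa using D.comp_mul_le (σ * τ) (σ * τ)⁻¹) ?_
        calc D.comp 1 = D.comp σ * D.comp σ⁻¹ := hσ.2.symm
          _ = D.comp σ * ((D.comp τ * D.comp τ⁻¹) * D.comp σ⁻¹) := by
            rw [show D.comp τ * D.comp τ⁻¹ = D.comp 1 from hτ.2, D.one_mul_comp]
          _ = (D.comp σ * D.comp τ) * (D.comp τ⁻¹ * D.comp σ⁻¹) := by simp only [mul_assoc]
          _ ≤ D.comp (σ * τ) * D.comp (σ * τ)⁻¹ := by
            rw [mul_inv_rev]
            exact Submodule.mul_le.mpr fun x hx y hy => Submodule.mul_mem_mul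
              (D.comp_mul_le σ τ hx) (D.comp_mul_le τ⁻¹ σ⁻¹ hy)⟩ }
  { M with
    inv_mem' := fun {σ} hσ => by
      have h : σ⁻¹ ∈ Submonoid.powers σ := by
        rw [(isOfFinOrder_of_finite σ).mem_powers_iff_mem_zpowers]
        exact inv_mem (Subgroup.mem_zpowers σ)
      obtain ⟨n, hn⟩ := h
      change σ⁻¹ ∈ M
      rw [← hn]
      exact pow_mem (show σ ∈ M from hσ) n }

theorem coe_group [Finite H] (D : Datum R K) :
    (D.group : Set (H ⧸ K)) = cliffordSet K (stab D.L D.e) D.L D.F D.e := rfl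

variable [Finite H]

/-! ### The algebra `C`, its quotient `C̄ = C/CJ(C_1)` and the group of homogeneous units -/

/-- The set `C = ⊕_{σ ∈ G[e]} C_σ ⊆ RH`, closed under multiplication. -/
def total (D : Datum R K) : NonUnitalSubalgebra R (MonoidAlgebra R H) :=
  { (⨆ σ : D.group, D.comp σ : Submodule R (MonoidAlgebra R H)) with
    mul_mem' := fun {x y} hx hy => by
      have h := Submodule.mul_mem_mul hx hy
      rw [Submodule.iSup_mul] at h
      refine (iSup_le fun σ => ?_ : _ ≤ (⨆ σ : D.group, D.comp σ)) h
      rw [Submodule.mul_iSup]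
      exact iSup_le fun τ => (D.comp_mul_le σ τ).trans
        (le_iSup (fun σ : D.group => D.comp (σ : H ⧸ K)) (σ * τ)) }

theorem comp_le_total (D : Datum R K) {σ : H ⧸ K} (hσ : σ ∈ D.group) {x : MonoidAlgebra R H}
    (hx : x ∈ D.comp σ) : x ∈ D.total :=
  (le_iSup (fun σ : D.group => D.comp (σ : H ⧸ K)) ⟨σ, hσ⟩) hx

theorem total_induction (D : Datum R K) {p : MonoidAlgebra R H → Prop}
    (hc : ∀ σ ∈ D.group, ∀ x ∈ D.comp σ, p x) (h0 : p 0) (ha : ∀ x y, p x → p y → p (x + y))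
    {x : MonoidAlgebra R H} (hx : x ∈ D.total) : p x :=
  Submodule.iSup_induction (fun σ : D.group => D.comp (σ : H ⧸ K)) (motive := p) hx
    (fun σ x hx => hc σ σ.2 x hx) h0 ha

theorem fixedBy_of_mem_total (D : Datum R K) {x : MonoidAlgebra R H} (hx : x ∈ D.total) :
    FixedBy D.F x :=
  D.total_induction (fun _ _ _ hx => (D.mem_comp.mp hx).2.1) (fun _ _ => map_zero _)
    (fun x y hx hy g hg => by rw [map_add, hx g hg, hy g hg]) hx

theorem e_mul_of_mem_total (D : Datum R K) {x : MonoidAlgebra R H} (hx : x ∈ D.total) :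
    D.e * x = x :=
  D.total_induction (fun _ _ _ hx => (D.mem_comp.mp hx).2.2) (mul_zero _)
    (fun x y hx hy => by rw [mul_add, hx, hy]) hx

/-- The algebra `C = ⊕_{σ ∈ G[e]} C_σ`. -/
abbrev Alg (D : Datum R K) : Type _ := ↥D.total

/-- The ring structure of `C`; the identity element is `e`. -/
instance instRing (D : Datum R K) : Ring D.Alg :=
  { (inferInstance : NonUnitalRing D.total) with
    one := ⟨D.e, D.comp_le_total D.group.one_mem D.e_mem⟩
    one_mul := fun x => Subtype.ext (D.e_mul_of_mem_total x.2)
    mul_one := fun x => Subtype.ext (by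
      change x.1 * D.e = x.1
      rw [← D.e_comm (D.fixedBy_of_mem_total x.2)]
      exact D.e_mul_of_mem_total x.2) }

theorem coe_one (D : Datum R K) : ((1 : D.Alg) : MonoidAlgebra R H) = D.e := rfl

theorem coe_mul (D : Datum R K) (x y : D.Alg) :
    ((x * y : D.Alg) : MonoidAlgebra R H) = (x : MonoidAlgebra R H) * y := rfl

instance instAlgebra (D : Datum R K) : Algebra R D.Alg :=
  Algebra.ofModule (fun r x y => smul_mul_assoc r x y) (fun r x y => mul_smul_comm r x y)

/-- The identity component `C_1` of `C`. -/
def algOne (D : Datum R K) : Subalgebra R D.Alg where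
  carrier := {x : D.Alg | (x : MonoidAlgebra R H) ∈ D.comp 1}
  mul_mem' := fun {x y} hx hy => by
    have h := D.mul_mem_comp hx hy
    rw [mul_one] at h
    exact h
  add_mem' := fun {x y} hx hy => (D.comp 1).add_mem hx hy
  algebraMap_mem' := fun r => by
    rw [Algebra.algebraMap_eq_smul_one]
    exact (D.comp 1).smul_mem r D.e_mem

theorem mem_algOne (D : Datum R K) {x : D.Alg} :
    x ∈ D.algOne ↔ (x : MonoidAlgebra R H) ∈ D.comp 1 := Iff.rfl

theorem algOne_comm (D : Datum R K) {x y : D.Alg} (hx : x ∈ D.algOne) : x * y = y * x := by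
  refine Subtype.ext (SupportedOn.commute (F := D.F) (fun h hh => D.le ?_)
    (D.fixedBy_of_mem_total y.2))
  have h1 := (D.mem_comp.mp (D.mem_algOne.mp hx)).1 h hh
  exact ⟨h1.1, (QuotientGroup.eq_one_iff h).mp h1.2⟩

/-- The ideal `CJ(C_1)` of `C`. -/
def rad (D : Datum R K) : Ideal D.Alg := (Ring.jacobson D.algOne).map D.algOne.val

instance instIsTwoSided (D : Datum R K) : D.rad.IsTwoSided where
  mul_mem_of_left := fun {a} c ha => by
    refine Submodule.span_induction (p := fun a _ => a * c ∈ D.rad) ?_ (by simp) ?_ ?_ ha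
    · rintro _ ⟨j, hj, rfl⟩
      change (j : D.Alg) * c ∈ _
      rw [D.algOne_comm j.2]
      exact D.rad.mul_mem_left c (Ideal.mem_map_of_mem D.algOne.val hj)
    · intro x y _ _ hx hy
      rw [add_mul]
      exact D.rad.add_mem hx hy
    · intro r x _ hx
      rw [smul_eq_mul, mul_assoc]
      exact D.rad.mul_mem_left r hx

/-- The algebra `C̄ = C/CJ(C_1)`. -/
abbrev Bar (D : Datum R K) : Type _ := D.Alg ⧸ D.rad

/-- The ring `C̄_1 = C_1/J(C_1)`. -/
abbrev BarOne (D : Datum R K) : Type _ := D.algOne ⧸ Ring.jacobson D.algOne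

/-- The canonical map `C̄_1 → C̄`. -/
def barIncl (D : Datum R K) : D.BarOne →+* D.Bar :=
  Ideal.quotientMap D.rad D.algOne.val.toRingHom fun _ hj => Ideal.mem_map_of_mem D.algOne.val hj

/-- The component `C̄_σ` of `C̄`: the image of `C_σ`. -/
def barComp (D : Datum R K) (σ : D.group) : Set D.Bar :=
  {z | ∃ x : D.Alg, (x : MonoidAlgebra R H) ∈ D.comp σ ∧ Ideal.Quotient.mk D.rad x = z}

theorem mul_mem_barComp (D : Datum R K) {σ τ : D.group} {z w : D.Bar}
    (hz : z ∈ D.barComp σ) (hw : w ∈ D.barComp τ) : z * w ∈ D.barComp (σ * τ) := by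
  obtain ⟨x, hx, rfl⟩ := hz
  obtain ⟨y, hy, rfl⟩ := hw
  exact ⟨x * y, D.mul_mem_comp hx hy, map_mul _ _ _⟩

/-- The group `hU(C̄)` of homogeneous units of `C̄`. (If a unit is homogeneous of degree `σ`, then
its inverse is homogeneous of degree `σ⁻¹`.) -/
def hU (D : Datum R K) : Subgroup D.Barˣ where
  carrier := {u | ∃ σ : D.group, (u : D.Bar) ∈ D.barComp σ ∧ ((u⁻¹ : D.Barˣ) : D.Bar) ∈ D.barComp σ⁻¹}
  one_mem' := ⟨1, ⟨1, D.e_mem, rfl⟩, by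
    rw [inv_one, inv_one]; exact ⟨1, D.e_mem, rfl⟩⟩
  mul_mem' := by
    rintro u v ⟨σ, h1, h2⟩ ⟨τ, h3, h4⟩
    refine ⟨σ * τ, D.mul_mem_barComp h1 h3, ?_⟩
    rw [mul_inv_rev, mul_inv_rev]
    exact D.mul_mem_barComp h4 h2
  inv_mem' := by
    rintro u ⟨σ, h1, h2⟩
    exact ⟨σ⁻¹, h2, by rwa [inv_inv, inv_inv]⟩

/-- `S` is the Clifford extension `1 → C̄_1ˣ → hU(C̄) → G[e] → 1`: a short exact sequence in which
the first map is the canonical one and the second one takes a homogeneous unit to its degree. -/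
structure IsCliffordExtension (D : Datum R K) (S : GroupExtension D.BarOneˣ D.hU D.group) :
    Prop where
  inl_eq : ∀ u : D.BarOneˣ, (((S.inl u : D.hU) : D.Barˣ) : D.Bar) = D.barIncl u
  rightHom_eq : ∀ u : D.hU, ((u : D.Barˣ) : D.Bar) ∈ D.barComp (S.rightHom u)

/-! ### The conjugation action on `C̄` -/

/-- The subgroup of all `n ∈ H` normalizing `L` and `F` and fixing `e`: it acts on `C`
by conjugation. -/
def actGroup (D : Datum R K) : Subgroup H :=
  stab (Subgroup.normalizer (D.L : Set H) ⊓ Subgroup.normalizer (D.F : Set H)) D.e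

theorem conj_mem_comp (D : Datum R K) {n : H} (hn : n ∈ D.actGroup) {σ : H ⧸ K}
    {x : MonoidAlgebra R H} (hx : x ∈ D.comp σ) :
    conj R n x ∈ D.comp ((n : H ⧸ K) * σ * (n : H ⧸ K)⁻¹) := by
  rw [mem_comp] at *
  obtain ⟨⟨hL, hF⟩, he⟩ := hn
  refine ⟨fun h hh => ?_, fun g hg => ?_, ?_⟩
  · rw [coeff_conj] at hh
    obtain ⟨h1, h2⟩ := hx.1 _ hh
    refine ⟨?_, ?_⟩
    · have := (Subgroup.mem_normalizer_iff.mp hL _).mp h1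
      simpa [mul_assoc] using this
    · rw [← h2]
      simp [mul_assoc]
  · have hg' : n⁻¹ * g * n ∈ D.F := by
      have := (Subgroup.mem_normalizer_iff.mp (inv_mem hF) g).mp hg
      simpa using this
    calc conj R g (conj R n x) = conj R (n * (n⁻¹ * g * n)) x := by
          rw [← conj_mul]; congr 2; group
      _ = conj R n x := by rw [conj_mul, hx.2.1 _ hg']
  · conv_lhs => rw [← he]
    rw [← map_mul, hx.2.2]

theorem map_conj_comp (D : Datum R K) {n : H} (hn : n ∈ D.actGroup) (σ : H ⧸ K) :
    (D.comp σ).map (conj R n).toLinearMap = D.comp ((n : H ⧸ K) * σ * (n : H ⧸ K)⁻¹) := by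
  refine le_antisymm (Submodule.map_le_iff_le_comap.mpr fun x hx => D.conj_mem_comp hn hx)
    fun x hx => ⟨conj R n⁻¹ x, ?_, conj_conj_inv R n x⟩
  have := D.conj_mem_comp (inv_mem hn) hx
  simpa [mul_assoc] using this

theorem conj_mem_group (D : Datum R K) {n : H} (hn : n ∈ D.actGroup) {σ : H ⧸ K}
    (hσ : σ ∈ D.group) : (n : H ⧸ K) * σ * (n : H ⧸ K)⁻¹ ∈ D.group := by
  obtain ⟨⟨h, hh, rfl⟩, h2⟩ := hσ
  refine ⟨⟨n * h * n⁻¹, ⟨?_, ?_⟩, rfl⟩, ?_⟩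
  · exact (Subgroup.mem_normalizer_iff.mp hn.1.1 h).mp hh.1
  · have hi := (inv_mem hn).2
    rw [conj_mul, conj_mul, hi, hh.2, hn.2]
  · have h3 := congrArg (Submodule.map (conj R n).toAlgHom.toLinearMap) h2
    rw [Submodule.map_mul] at h3
    have e1 := D.map_conj_comp hn (QuotientGroup.mk' K h)
    have e2 := D.map_conj_comp hn (QuotientGroup.mk' K h)⁻¹
    have e3 := D.map_conj_comp hn 1
    rw [mul_one, mul_inv_cancel] at e3
    rw [show (n : H ⧸ K) * (QuotientGroup.mk' K h)⁻¹ * (n : H ⧸ K)⁻¹ =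
      ((n : H ⧸ K) * (QuotientGroup.mk' K h) * (n : H ⧸ K)⁻¹)⁻¹ by group] at e2
    change D.comp _ * D.comp _ = D.comp 1
    rw [← e3, ← e2]
    refine Eq.trans ?_ h3
    congr 1
    exact e1.symm

/-- The action of `n` on `C`, `x ↦ n x n⁻¹`. -/
def actAlg (D : Datum R K) (n : D.actGroup) : D.Alg →+* D.Alg where
  toFun x := ⟨conj R (n : H) x, D.total_induction (p := fun x => conj R (n : H) x ∈ D.total)
    (fun _ hσ _ hx => D.comp_le_total (D.conj_mem_group n.2 hσ) (D.conj_mem_comp n.2 hx))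
    (by rw [map_zero]; exact zero_mem _)
    (fun x y hx hy => by rw [map_add]; exact add_mem hx hy) x.2⟩
  map_one' := Subtype.ext n.2.2
  map_mul' x y := Subtype.ext (map_mul (conj R (n : H)) x.1 y.1)
  map_zero' := Subtype.ext (map_zero (conj R (n : H)))
  map_add' x y := Subtype.ext (map_add (conj R (n : H)) x.1 y.1)

theorem actAlg_mem_algOne (D : Datum R K) (n : D.actGroup) {x : D.Alg} (hx : x ∈ D.algOne) :
    D.actAlg n x ∈ D.algOne := by
  have := D.conj_mem_comp n.2 (D.mem_algOne.mp hx)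
  rw [mul_one, mul_inv_cancel] at this
  exact D.mem_algOne.mpr this

/-- The action of `n` on `C_1`. -/
def actOne (D : Datum R K) (n : D.actGroup) : D.algOne →+* D.algOne :=
  ((D.actAlg n).comp D.algOne.val.toRingHom).codRestrict D.algOne.toSubring
    fun x => D.actAlg_mem_algOne n x.2

theorem actOne_surjective (D : Datum R K) (n : D.actGroup) :
    Function.Surjective (D.actOne n) := fun x =>
  ⟨D.actOne n⁻¹ x, Subtype.ext (Subtype.ext (conj_conj_inv R (n : H) x.1.1))⟩

theorem actAlg_mem_rad (D : Datum R K) (n : D.actGroup) :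
    D.rad ≤ D.rad.comap (D.actAlg n) := by
  refine Ideal.map_le_iff_le_comap.mpr fun j hj => ?_
  have : RingHomSurjective (D.actOne n) := ⟨D.actOne_surjective n⟩
  have h1 : D.actOne n j ∈ Ring.jacobson D.algOne := Ring.le_comap_jacobson (D.actOne n) hj
  exact Ideal.mem_map_of_mem D.algOne.val h1

/-- The action of `n` on `C̄`. -/
def act (D : Datum R K) (n : D.actGroup) : D.Bar →+* D.Bar :=
  Ideal.quotientMap D.rad (D.actAlg n) (D.actAlg_mem_rad n)

/-! ### Isomorphisms of Clifford extensions -/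

/-- The Clifford extensions `S` and `S'` of two data over `R` and `R'`, where `ρ : R → R'`, are
isomorphic compatibly with the action of `N`: there are an isomorphism `φ : C̄ ≃ C̄'` of rings, of
graded rings over `G[e] = G[e']`, and of `R`-algebras via `ρ`, commuting with the conjugation action
of `N`, and an isomorphism of short exact sequences given by `φ` on the homogeneous units and by the
identity of `G[e] = G[e']`. -/
def ExtensionIso {R' : Type*} [CommRing R'] (ρ : R →+* R') (N : Subgroup H)
    (D : Datum R K) (D' : Datum R' K) (S : GroupExtension D.BarOneˣ D.hU D.group)
    (S' : GroupExtension D'.BarOneˣ D'.hU D'.group) : Prop :=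
  ∃ (hG : D.group = D'.group) (hN : N ≤ D.actGroup) (hN' : N ≤ D'.actGroup)
    (φ : D.Bar ≃+* D'.Bar) (Φ : D.hU ≃* D'.hU) (κ : D.BarOneˣ ≃* D'.BarOneˣ),
    (∀ r : R, φ (algebraMap R D.Bar r) = algebraMap R' D'.Bar (ρ r)) ∧
    (∀ σ : D.group, φ '' D.barComp σ = D'.barComp ⟨σ, hG ▸ σ.2⟩) ∧
    (∀ (n : H) (hn : n ∈ N) (z : D.Bar), φ (D.act ⟨n, hN hn⟩ z) = D'.act ⟨n, hN' hn⟩ (φ z)) ∧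
    (∀ u : D.hU, (((Φ u : D'.hU) : D'.Barˣ) : D'.Bar) = φ ((u : D.Barˣ) : D.Bar)) ∧
    (∀ u : D.BarOneˣ, S'.inl (κ u) = Φ (S.inl u)) ∧
    (∀ u : D.hU, (S'.rightHom (Φ u) : H ⧸ K) = S.rightHom u)

end Datum

/-! ### The data of `b`, `b₁` and `b̄` -/

/-- The datum of a block `e` of `RM`, `M = L ∩ K`, inside `RL`, with `M`-fixed points. -/
def blockDatum {R : Type*} [CommRing R] {K : Subgroup H} (L M : Subgroup H) (hM : L ⊓ K = M)
    (e : MonoidAlgebra R H) (he : IsBlock M e) : Datum R K where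
  L := L
  F := M
  e := e
  le := hM.le
  supported := hM.symm ▸ he.supported
  fixed := he.fixedBy
  idem := he.idem

/-- A sum over a finite set acted on by a `p`-group, in characteristic `p`. -/
theorem sum_eq_sum_fixedPoints {p : ℕ} [Fact p.Prime] {k : Type*} [CommRing k] [CharP k p]
    {P α : Type*} [Group P] [MulAction P α] (hP : IsPGroup p P) [Fintype α] (f : α → k)
    (hf : ∀ (g : P) (a : α), f (g • a) = f a) [DecidablePred (· ∈ MulAction.fixedPoints P α)] :
    ∑ a, f a = ∑ a with a ∈ MulAction.fixedPoints P α, f a := by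
  classical
  have key : ∀ v : k, ((Finset.univ.filter fun a => f a = v).card : k) =
      ((Finset.univ.filter fun a => a ∈ MulAction.fixedPoints P α ∧ f a = v).card : k) := by
    intro v
    letI : MulAction P {a // f a = v} :=
      { smul := fun g a => ⟨g • a.1, (hf g a.1).trans a.2⟩
        one_smul := fun a => Subtype.ext (one_smul P a.1)
        mul_smul := fun g h a => Subtype.ext (mul_smul g h a.1) }
    have h1 := hP.card_modEq_card_fixedPoints {a // f a = v}
    have h2 : Nat.card {a // f a = v} = (Finset.univ.filter fun a => f a = v).card := by
      rw [Nat.card_eq_fintype_card, Fintype.card_subtype]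
    have h3 : Nat.card (MulAction.fixedPoints P {a // f a = v}) =
        (Finset.univ.filter fun a => a ∈ MulAction.fixedPoints P α ∧ f a = v).card := by
      rw [← Fintype.card_subtype, ← Nat.card_eq_fintype_card]
      exact Nat.card_congr
        { toFun := fun a => ⟨a.1.1, fun g => congrArg Subtype.val (a.2 g), a.1.2⟩
          invFun := fun a => ⟨⟨a.1, a.2.2⟩, fun g => Subtype.ext (a.2.1 g)⟩
          left_inv := fun _ => rfl
          right_inv := fun _ => rfl }
    rw [h2, h3] at h1
    exact (CharP.natCast_eq_natCast k p).mpr h1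
  have e1 : ∑ a, f a = ∑ v ∈ Finset.univ.image f,
      ((Finset.univ.filter fun a => f a = v).card : k) * v := by
    rw [← Finset.sum_fiberwise_of_maps_to (g := f) (t := Finset.univ.image f) (by simp)]
    refine Finset.sum_congr rfl fun v _ => ?_
    rw [Finset.sum_congr rfl (g := fun _ => v) (by simp)]
    simp
  have e2 : (∑ a with a ∈ MulAction.fixedPoints P α, f a) = ∑ v ∈ Finset.univ.image f,
      ((Finset.univ.filter fun a => a ∈ MulAction.fixedPoints P α ∧ f a = v).card : k) * v := by
    rw [← Finset.sum_fiberwise_of_maps_to (g := f) (t := Finset.univ.image f) (by simp)]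
    refine Finset.sum_congr rfl fun v _ => ?_
    rw [Finset.filter_filter, Finset.sum_congr rfl (g := fun _ => v) (by simp)]
    simp
  rw [e1, e2]
  exact Finset.sum_congr rfl fun v _ => by rw [key v]

section BrauerDatum

variable {O : Type*} [CommRing O] [IsLocalRing O]

open scoped Classical in
theorem coeff_brauerMap (P : Subgroup H) (a : MonoidAlgebra O H) (h : H) :
    (brauerMap O P a).coeff h =
      if h ∈ Subgroup.centralizer (P : Set H) then IsLocalRing.residue O (a.coeff h) else 0 := by
  simp [brauerMap, Finsupp.filter_apply]

theorem coeff_eq_of_fixedBy {R : Type*} [CommRing R] {F : Subgroup H} {a : MonoidAlgebra R H}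
    (ha : FixedBy F a) {g : H} (hg : g ∈ F) (h : H) : a.coeff (g * h * g⁻¹) = a.coeff h := by
  conv_lhs => rw [← ha g hg]
  rw [coeff_conj]
  congr 1
  group

/-- The Brauer homomorphism is multiplicative on the `P`-fixed elements. -/
theorem brauerMap_mul [Finite H] {p : ℕ} [Fact p.Prime] [CharP (IsLocalRing.ResidueField O) p]
    {P : Subgroup H} (hP : IsPGroup p P) {a c : MonoidAlgebra O H}
    (ha : FixedBy P a) (hc : FixedBy P c) :
    brauerMap O P (a * c) = brauerMap O P a * brauerMap O P c := by
  classical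
  have := Fintype.ofFinite H
  have expand : ∀ {R : Type _} [CommRing R] (x y : MonoidAlgebra R H) (z : H),
      (x * y).coeff z = ∑ h, x.coeff h * y.coeff (h⁻¹ * z) := by
    intro R _ x y z
    rw [MonoidAlgebra.coeff_mul_apply_left, Finsupp.sum_fintype _ _ (by simp)]
  ext z
  rw [coeff_brauerMap]
  split_ifs with hz
  · have hz' : ∀ g ∈ P, g * z = z * g := fun g hg => Subgroup.mem_centralizer_iff.mp hz g hg
    letI : MulAction P H := MulAction.compHom H (MulAut.conj.comp P.subtype)
    have smul_def : ∀ (g : P) (h : H), g • h = (g : H) * h * (g : H)⁻¹ := fun g h => rfl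
    have mem_fix : ∀ h : H, h ∈ MulAction.fixedPoints P H ↔
        h ∈ Subgroup.centralizer (P : Set H) := by
      intro h
      rw [Subgroup.mem_centralizer_iff]
      constructor
      · intro hh g hg
        have := hh ⟨g, hg⟩
        rw [smul_def] at this
        exact mul_inv_eq_iff_eq_mul.mp this
      · intro hh g
        rw [smul_def]
        exact mul_inv_eq_iff_eq_mul.mpr (hh g g.2)
    rw [expand, map_sum, sum_eq_sum_fixedPoints hP, expand, Finset.sum_filter]
    · refine Finset.sum_congr rfl fun h _ => ?_
      simp only [mem_fix, coeff_brauerMap, map_mul]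
      by_cases hh : h ∈ Subgroup.centralizer (P : Set H)
      · simp [hh, Subgroup.mul_mem _ (inv_mem hh) hz]
      · simp [hh]
    · intro g h
      rw [smul_def, coeff_eq_of_fixedBy ha g.2]
      congr 2
      rw [← coeff_eq_of_fixedBy hc g.2 (h⁻¹ * z)]
      congr 1
      have := hz' g g.2
      calc ((g : H) * h * (g : H)⁻¹)⁻¹ * z = (g : H) * h⁻¹ * (g : H)⁻¹ * z := by group
        _ = (g : H) * h⁻¹ * (g : H)⁻¹ * (((g : H) * z) * (g : H)⁻¹) := by
          rw [this]; group
        _ = (g : H) * (h⁻¹ * z) * (g : H)⁻¹ := by group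
  · symm
    rw [expand]
    refine Finset.sum_eq_zero fun h _ => ?_
    rw [coeff_brauerMap, coeff_brauerMap]
    by_cases hh : h ∈ Subgroup.centralizer (P : Set H)
    · have : h⁻¹ * z ∉ Subgroup.centralizer (P : Set H) := fun h2 => hz (by
        simpa using mul_mem hh h2)
      simp [this]
    · simp [hh]

theorem FixedBy.brauerMap {P F : Subgroup H} {a : MonoidAlgebra O H} (ha : FixedBy F a)
    (hF : F ≤ Subgroup.normalizer (P : Set H)) : FixedBy F (brauerMap O P a) := by
  intro g hg
  have hc : ∀ h, g⁻¹ * h * g ∈ Subgroup.centralizer (P : Set H) ↔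
      h ∈ Subgroup.centralizer (P : Set H) := by
    have hn : ∀ (g : H), g ∈ Subgroup.normalizer (P : Set H) → ∀ h,
        h ∈ Subgroup.centralizer (P : Set H) →
        g⁻¹ * h * g ∈ Subgroup.centralizer (P : Set H) := by
      intro g hg h hh
      rw [Subgroup.mem_centralizer_iff] at *
      intro x hx
      have h1 := hh _ ((Subgroup.mem_normalizer_iff.mp hg x).mp hx)
      calc x * (g⁻¹ * h * g) = g⁻¹ * ((g * x * g⁻¹) * h) * g := by group
        _ = g⁻¹ * (h * (g * x * g⁻¹)) * g := by rw [h1]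
        _ = g⁻¹ * h * g * x := by group
    intro h
    refine ⟨fun h1 => ?_, hn g (hF hg) h⟩
    have := hn g⁻¹ (inv_mem (hF hg)) _ h1
    simpa [mul_assoc] using this
  ext h
  classical
  rw [coeff_conj, coeff_brauerMap, coeff_brauerMap, ← coeff_eq_of_fixedBy ha (F.inv_mem hg) h]
  simp [hc]

/-- The datum of `b̄ = Br_P(b)`, for a block `b` of `OK` with defect group `P`: the group algebra
`kC_H(P)` graded by `C_H(P)/C_K(P)`, with `N_K(P)`-fixed points. -/
def brauerDatum [Finite H] {p : ℕ} [Fact p.Prime] [CharP (IsLocalRing.ResidueField O) p]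
    (K P : Subgroup H) (b : MonoidAlgebra O H) (hb : IsBlock K b) (hP : IsDefectGroup p K P b) :
    Datum (IsLocalRing.ResidueField O) K where
  L := Subgroup.centralizer (P : Set H)
  F := normIn K P
  e := brauerMap O P b
  le := inf_le_inf_right K (Subgroup.centralizer_le_normalizer _)
  supported := fun h hh => by
    classical
    rw [coeff_brauerMap] at hh
    split_ifs at hh with hc
    · exact ⟨hc, hb.supported h fun h0 => hh (by rw [h0, map_zero])⟩
    · exact absurd rfl hh
  fixed := FixedBy.brauerMap (fun g hg => hb.fixedBy g hg.2) inf_le_left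
  idem := by
    have h : FixedBy P b := fun g hg => hb.fixedBy g (hP.le hg)
    rw [← brauerMap_mul hP.isPGroup h h, hb.idem]

end BrauerDatum

end BlockClifford

end

/-! The whole comparison is made by one map, the Brauer homomorphism $\mathrm{Br}_P$. It is
multiplicative on $P$-fixed elements, respects degrees, and commutes with conjugation by $N_H(P)$.
It maps each component $C_\sigma$ of case (1') and of case (2') into the component of degree
$\sigma$ in case (3'). It maps onto that component because the block is a relative trace
$\mathrm{Tr}_P(a)$: if $x$ lifts $y$, then $e\,\mathrm{Tr}_P(ax)$ is a preimage of $y$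
(`isGradedMap_brauerMap`).

The rest depends on $C_1$ being local. Then $C_\sigma C_{\sigma^{-1}}=C_1$ holds exactly when
$C_\sigma$ contains $x$ and $C_{\sigma^{-1}}$ contains $y$ with $xy=e$. Hence $C$ is a crossed
product of $C_1$ with $\Gamma$ (`exists_homogeneous_unit`), and the Clifford extension is exact. A
surjection from a local ring to a nonzero ring reflects units. A graded map therefore preserves and
reflects the condition on $\sigma$, pulls $C'J(C'_1)$ back to $CJ(C_1)$ (`algMap_mem_rad`), and
induces an isomorphism of the rings $\bar C$. Cases (1') and (2') are compared through (3').

Locality travels in two directions. From (1') it descends to (3') along the surjection. From (3') it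
is lifted to (2'): if $x\in(\mathcal ON_H(P))^P$ and $\mathrm{Br}_P(x)=0$, then multiplication by
$1-x$ is bijective (`bijective_one_sub_mul`), so $\mathrm{Br}_P$ reflects units on $b_1Z(\mathcal
ON_K(P))$. No completeness is needed for this lift.

The index sets agree because a $\sigma$ satisfying the condition in (3') meets $C_H(P)$, and $K$
fixes $b$. The stabilizers agree because distinct blocks are orthogonal, while $\mathrm{Br}_P$ does
not vanish on the blocks in question. -/

noncomputable section

namespace BlockClifford

variable {H : Type*} [Group H]

/-! ### Locality from the absence of idempotents, over a complete ring -/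

section Complete

open scoped TensorProduct

/-- A finite module over a complete Noetherian local ring is complete. -/
theorem isAdicComplete_of_finite {O : Type*} [CommRing O] [IsLocalRing O] [IsNoetherianRing O]
    [IsAdicComplete (IsLocalRing.maximalIdeal O) O] (M : Type*) [AddCommGroup M] [Module O M]
    [Module.Finite O M] : IsAdicComplete (IsLocalRing.maximalIdeal O) M := by
  have hpre : IsPrecomplete (IsLocalRing.maximalIdeal O) M := by
    rw [← AdicCompletion.of_surjective_iff]
    intro y
    obtain ⟨t, rfl⟩ :=
      AdicCompletion.ofTensorProduct_surjective_of_finite (IsLocalRing.maximalIdeal O) M y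
    induction t with
    | zero => exact ⟨0, by simp⟩
    | add a b ha hb =>
      obtain ⟨x, hx⟩ := ha
      obtain ⟨z, hz⟩ := hb
      exact ⟨x + z, by rw [map_add, map_add, hx, hz]⟩
    | tmul r m =>
      obtain ⟨s, rfl⟩ := AdicCompletion.of_surjective (IsLocalRing.maximalIdeal O) O r
      refine ⟨s • m, ?_⟩
      rw [AdicCompletion.ofTensorProduct_tmul, map_smul]
      ext n
      rfl
  -- Separatedness is supplied by instance search; only precompleteness had to be proved.
  exact { }

/-- A finite commutative algebra without nontrivial idempotents over a complete Noetherian local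
ring is local. -/
theorem isLocalRing_of_finite_of_isAdicComplete {O : Type*} [CommRing O] [IsLocalRing O]
    [IsNoetherianRing O] [IsAdicComplete (IsLocalRing.maximalIdeal O) O] (S : Type*) [CommRing S]
    [Nontrivial S] [Algebra O S] [Module.Finite O S]
    (hS : ∀ a : S, a * a = a → a = 0 ∨ a = 1) : IsLocalRing S := by
  set I : Ideal S := (IsLocalRing.maximalIdeal O).map (algebraMap O S)
  have hc : IsAdicComplete I S :=
    (IsAdicComplete.map_algebraMap_iff (S := S) (M := S)
      (I := IsLocalRing.maximalIdeal O)).mpr (isAdicComplete_of_finite S)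
  have hloc := isLocalHom_of_le_jacobson_bot I (IsAdicComplete.le_jacobson_bot I)
  have hart : IsArtinianRing (S ⧸ I) := by
    have : Module.Finite (O ⧸ IsLocalRing.maximalIdeal O) (S ⧸ I) := inferInstance
    let := Ideal.Quotient.field (IsLocalRing.maximalIdeal O)
    exact IsArtinianRing.of_finite (O ⧸ IsLocalRing.maximalIdeal O) (S ⧸ I)
  refine IsLocalRing.of_isUnit_or_isUnit_one_sub_self fun x => ?_
  set q := Ideal.Quotient.mk I
  -- The powers of $\bar x$ stabilize in the Artinian quotient: $\bar x^n=\bar x^{n+1}y$. Iterating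
  -- gives $\bar x^n=\bar x^{2n}y^n$, so $\bar x^ny^n$ is idempotent; it lifts to an idempotent of
  -- $S$.
  obtain ⟨n, y, hy⟩ := IsArtinian.exists_pow_succ_smul_dvd (q x) (1 : S ⧸ I)
  simp only [smul_eq_mul, mul_one] at hy
  have h1 : ∀ m, q x ^ n = q x ^ (n + m) * y ^ m := by
    intro m
    induction m with
    | zero => simp
    | succ m ih =>
      calc q x ^ n = q x ^ (n + m) * y ^ m := ih
        _ = q x ^ n * (q x ^ m * y ^ m) := by ring
        _ = _ := by rw [← hy, Nat.succ_eq_add_one]; ring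
  obtain ⟨a₀, ha₀⟩ := Ideal.Quotient.mk_surjective (q x ^ n * y ^ n)
  have hidem : (q x ^ n * y ^ n) * (q x ^ n * y ^ n) = q x ^ n * y ^ n := by
    conv_rhs => rw [h1 n]
    ring
  have hmem : a₀ * a₀ - a₀ ∈ I := by
    rw [← Ideal.Quotient.eq, map_mul, ha₀, hidem]
  have hmonic : (Polynomial.X ^ 2 - Polynomial.X : Polynomial S).Monic := by
    monicity!
  obtain ⟨a, ha, haI⟩ := HenselianRing.is_henselian (I := I)
    (Polynomial.X ^ 2 - Polynomial.X : Polynomial S)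
    hmonic a₀
    (by simpa [pow_two] using hmem) (by
      -- The derivative $2a_0-1$ of $X^2-X$ is its own inverse modulo $I$, since its square is
      -- $1+4(a_0^2-a_0)$.
      have : (2 * a₀ - 1) * (2 * a₀ - 1) - 1 ∈ I := by
        have h4 := I.mul_mem_left 4 hmem
        convert h4 using 1
        ring
      rw [← Ideal.Quotient.eq] at this
      refine IsUnit.of_mul_eq_one (q (2 * a₀ - 1)) ?_
      have h5 : ((Polynomial.X ^ 2 - Polynomial.X : Polynomial S).derivative.eval a₀) =
          2 * a₀ - 1 := by simp [one_add_one_eq_two]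
      rw [h5, ← map_mul, this, map_one])
  have haa : a * a = a := by
    simpa [pow_two, sub_eq_zero] using ha
  rw [← Ideal.Quotient.eq, ha₀] at haI
  -- If the idempotent is $0$, then $\bar x^n=\bar x^n(\bar x^ny^n)=0$ and $1-x$ is a unit. If it is
  -- $1$, then $\bar x$ is a unit; here $n=0$ is separate, with $\bar xy=1$ directly.
  rcases hS a haa with rfl | rfl
  · right
    refine IsUnit.of_map q _ ?_
    rw [map_sub, map_one]
    refine IsNilpotent.isUnit_one_sub ⟨n, ?_⟩
    rw [h1 n, pow_add, mul_assoc]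
    rw [map_zero] at haI
    rw [← haI, mul_zero]
  · left
    refine IsUnit.of_map q _ ?_
    rw [map_one] at haI
    rcases Nat.eq_zero_or_pos n with rfl | hn
    · exact IsUnit.of_mul_eq_one y (by simpa using hy)
    · have : IsUnit (q x ^ n) := IsUnit.of_mul_eq_one _ haI.symm
      exact (isUnit_pow_iff hn.ne').mp this

end Complete

/-! ### The projection of a group algebra onto that of a subgroup -/

section Restrict

variable {R : Type*} [CommRing R]

open scoped Classical in
/-- The projection `RH → RS` which forgets the coefficients outside of the subgroup `S`. -/
def restrict (R : Type*) [CommRing R] (S : Subgroup H) :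
    MonoidAlgebra R H →ₗ[R] MonoidAlgebra R H where
  toFun a := MonoidAlgebra.ofCoeff (a.coeff.filter (· ∈ S))
  map_add' a c := by ext h; simp [Finsupp.filter_add]
  map_smul' r a := by ext h; simp [Finsupp.filter_apply]

open scoped Classical in
theorem coeff_restrict (S : Subgroup H) (a : MonoidAlgebra R H) (h : H) :
    (restrict R S a).coeff h = if h ∈ S then a.coeff h else 0 := by
  simp [restrict, Finsupp.filter_apply]

theorem supportedOn_restrict (S : Subgroup H) (a : MonoidAlgebra R H) :
    SupportedOn S (restrict R S a) := by
  classical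
  intro h hh
  rw [coeff_restrict] at hh
  by_contra h1
  simp [h1] at hh

theorem restrict_eq_self {S : Subgroup H} {a : MonoidAlgebra R H} (ha : SupportedOn S a) :
    restrict R S a = a := by
  classical
  ext h
  rw [coeff_restrict]
  split_ifs with h1
  · rfl
  · by_contra h2
    exact h1 (ha h (Ne.symm h2))

theorem restrict_eq_zero {S : Subgroup H} {a : MonoidAlgebra R H}
    (ha : ∀ h, a.coeff h ≠ 0 → h ∉ S) : restrict R S a = 0 := by
  classical
  ext h
  rw [coeff_restrict]
  split_ifs with h1
  · by_contra h2
    exact ha h h2 h1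
  · rfl

theorem not_mem_of_coeff_sub_restrict {S : Subgroup H} {a : MonoidAlgebra R H} {h : H}
    (hh : (a - restrict R S a).coeff h ≠ 0) : h ∉ S := by
  classical
  intro h1
  apply hh
  simp [coeff_restrict, h1]

/-- For $y\in S$ one has $xy\in S$ only if $x\in S$, so the part of $a$ outside $S$ contributes
nothing after multiplication by $c$. -/
theorem restrict_mul {S : Subgroup H} (a : MonoidAlgebra R H) {c : MonoidAlgebra R H}
    (hc : SupportedOn S c) : restrict R S (a * c) = restrict R S a * c := by
  have h1 : restrict R S ((a - restrict R S a) * c) = 0 := restrict_eq_zero ?_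
  · rwa [sub_mul, map_sub, restrict_eq_self ((supportedOn_restrict S a).mul hc), sub_eq_zero] at h1
  intro h hh hS
  obtain ⟨x, y, hx, hy, rfl⟩ := exists_coeff_ne_zero_of_mul hh
  exact not_mem_of_coeff_sub_restrict hx ((S.mul_mem_cancel_right (hc y hy)).mp hS)

theorem mul_restrict {S : Subgroup H} {a : MonoidAlgebra R H} (c : MonoidAlgebra R H)
    (ha : SupportedOn S a) : restrict R S (a * c) = a * restrict R S c := by
  have h1 : restrict R S (a * (c - restrict R S c)) = 0 := restrict_eq_zero ?_
  · rwa [mul_sub, map_sub, restrict_eq_self (ha.mul (supportedOn_restrict S c)), sub_eq_zero] at h1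
  intro h hh hS
  obtain ⟨x, y, hx, hy, rfl⟩ := exists_coeff_ne_zero_of_mul hh
  exact not_mem_of_coeff_sub_restrict hy ((S.mul_mem_cancel_left (ha x hx)).mp hS)

end Restrict

/-! ### The projection of $C$ onto $C_1$ and the ideal $CJ(C_1)$ -/

namespace Datum

variable {R : Type*} [CommRing R] {K : Subgroup H} [K.Normal]

theorem restrict_of_mem_comp_one (D : Datum R K) {x : MonoidAlgebra R H} (hx : x ∈ D.comp 1) :
    restrict R K x = x :=
  restrict_eq_self fun h hh => (QuotientGroup.eq_one_iff h).mp ((D.mem_comp.mp hx).1 h hh).2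

theorem restrict_of_mem_comp (D : Datum R K) {σ : H ⧸ K} (hσ : σ ≠ 1) {x : MonoidAlgebra R H}
    (hx : x ∈ D.comp σ) : restrict R K x = 0 :=
  restrict_eq_zero fun h hh hK => hσ
    (((D.mem_comp.mp hx).1 h hh).2.symm.trans ((QuotientGroup.eq_one_iff h).mpr hK))

variable [Finite H]

/-- The algebra `C_1` is commutative. -/
abbrev commRing (D : Datum R K) : CommRing D.algOne :=
  { (inferInstance : Ring D.algOne) with
    mul_comm := fun x _ => Subtype.ext (D.algOne_comm x.2) }

/-- The projection `C → C_1`. -/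
def proj (D : Datum R K) : D.Alg →ₗ[R] D.algOne where
  toFun x :=
    have h : restrict R K (x : MonoidAlgebra R H) ∈ D.comp 1 :=
      D.total_induction (p := fun x => restrict R K x ∈ D.comp 1)
        (fun σ _ _ hx => by
          by_cases h : σ = 1
          · subst h
            rwa [D.restrict_of_mem_comp_one hx]
          · rw [D.restrict_of_mem_comp h hx]
            exact zero_mem _)
        (by rw [map_zero]; exact zero_mem _)
        (fun _ _ hx hy => by rw [map_add]; exact add_mem hx hy) x.2
    ⟨⟨restrict R K (x : MonoidAlgebra R H), D.comp_le_total D.group.one_mem h⟩, h⟩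
  map_add' x y := Subtype.ext (Subtype.ext (map_add (restrict R K) x.1 y.1))
  map_smul' r x := Subtype.ext (Subtype.ext (map_smul (restrict R K) r x.1))

theorem proj_coe (D : Datum R K) (c : D.algOne) : D.proj c = c :=
  Subtype.ext (Subtype.ext (D.restrict_of_mem_comp_one c.2))

theorem proj_eq_zero (D : Datum R K) {σ : H ⧸ K} (hσ : σ ≠ 1) {x : D.Alg}
    (hx : (x : MonoidAlgebra R H) ∈ D.comp σ) : D.proj x = 0 :=
  Subtype.ext (Subtype.ext (D.restrict_of_mem_comp hσ hx))

theorem proj_mul (D : Datum R K) (x : D.Alg) (c : D.algOne) :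
    D.proj (x * (c : D.Alg)) = D.proj x * c :=
  Subtype.ext (Subtype.ext (restrict_mul _ fun h hh =>
    (QuotientGroup.eq_one_iff h).mp ((D.mem_comp.mp c.2).1 h hh).2))

theorem alg_induction (D : Datum R K) {p : D.Alg → Prop}
    (hc : ∀ σ ∈ D.group, ∀ x : D.Alg, (x : MonoidAlgebra R H) ∈ D.comp σ → p x) (h0 : p 0)
    (ha : ∀ x y, p x → p y → p (x + y)) (x : D.Alg) : p x := by
  obtain ⟨x, hx⟩ := x
  have := D.total_induction (p := fun x => ∃ h : x ∈ D.total, p ⟨x, h⟩)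
    (fun σ hσ x hx => ⟨D.comp_le_total hσ hx, hc σ hσ _ hx⟩) ⟨zero_mem _, h0⟩
    (fun _ _ ⟨hx, hpx⟩ ⟨hy, hpy⟩ => ⟨add_mem hx hy, ha _ _ hpx hpy⟩) hx
  exact this.2

/-- The projection is right $C_1$-linear, so it takes $aj$ with $j\in J(C_1)$ to
$\mathrm{proj}(a)j$. It is not left $C$-linear; the induction over the left ideal therefore carries
an arbitrary left factor. -/
theorem proj_mem_jacobson (D : Datum R K) {x : D.Alg} (hx : x ∈ D.rad) :
    D.proj x ∈ Ring.jacobson D.algOne := by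
  suffices h : ∀ a : D.Alg, D.proj (a * x) ∈ Ring.jacobson D.algOne by simpa using h 1
  refine Submodule.span_induction
    (p := fun x _ => ∀ a : D.Alg, D.proj (a * x) ∈ Ring.jacobson D.algOne) ?_ ?_ ?_ ?_ hx
  · rintro _ ⟨j, hj, rfl⟩ a
    change D.proj (a * (j : D.Alg)) ∈ _
    rw [D.proj_mul]
    exact Ideal.mul_mem_left _ _ hj
  · intro a
    simp
  · intro x y _ _ hx hy a
    rw [mul_add, map_add]
    exact add_mem (hx a) (hy a)
  · intro r x _ hx a
    rw [smul_eq_mul, ← mul_assoc]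
    exact hx _

/-- Since the projection is the identity on $C_1$, the ideal $CJ(C_1)$ meets $C_1$ only in $J(C_1)$.
This is what makes $\bar C_1\to\bar C$ injective. -/
theorem coe_mem_rad (D : Datum R K) {c : D.algOne} :
    (c : D.Alg) ∈ D.rad ↔ c ∈ Ring.jacobson D.algOne :=
  ⟨fun h => by simpa [proj_coe] using D.proj_mem_jacobson h,
    fun h => Ideal.mem_map_of_mem D.algOne.val h⟩

theorem barIncl_injective (D : Datum R K) : Function.Injective D.barIncl := by
  intro z w h
  obtain ⟨c, rfl⟩ := Ideal.Quotient.mk_surjective z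
  obtain ⟨d, rfl⟩ := Ideal.Quotient.mk_surjective w
  change Ideal.Quotient.mk D.rad (c : D.Alg) = Ideal.Quotient.mk D.rad (d : D.Alg) at h
  rw [Ideal.Quotient.eq] at h
  exact Ideal.Quotient.eq.mpr (D.coe_mem_rad.mp h)

/-! ### Crossed products and the Clifford extension when $C_1$ is local -/

section Local

variable (D : Datum R K) [IsLocalRing D.algOne]

attribute [local instance] commRing

/-- If `C_1` is local, then `C_σ C_{σ⁻¹} = C_1` only if `C_σ` contains a right invertible element.
-/
theorem exists_mul_eq_e {σ : H ⧸ K} (h : D.comp σ * D.comp σ⁻¹ = D.comp 1) :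
    ∃ x ∈ D.comp σ, ∃ y ∈ D.comp σ⁻¹, x * y = D.e := by
  have hsub : ∀ x ∈ D.comp σ, ∀ y ∈ D.comp σ⁻¹, x * y ∈ D.comp 1 := fun x hx y hy => by
    simpa using D.mul_mem_comp hx hy
  by_cases hu : ∃ (x : MonoidAlgebra R H) (hx : x ∈ D.comp σ) (y : MonoidAlgebra R H)
      (hy : y ∈ D.comp σ⁻¹), IsUnit (⟨⟨x * y, D.comp_le_total D.group.one_mem (hsub x hx y hy)⟩,
        hsub x hx y hy⟩ : D.algOne)
  · obtain ⟨x, hx, y, hy, hxy⟩ := hu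
    obtain ⟨c, hc⟩ := hxy.exists_right_inv
    refine ⟨x, hx, y * (c : D.Alg), by simpa using D.mul_mem_comp hy c.2, ?_⟩
    rw [← mul_assoc]
    exact congrArg (fun z : D.algOne => ((z : D.Alg) : MonoidAlgebra R H)) hc
  -- If no product $xy$ is a unit, all of them lie in the maximal ideal. So do their sums, among
  -- which is $e$, the identity of $C_1$.
  · exfalso
    push Not at hu
    have key : ∀ z ∈ D.comp σ * D.comp σ⁻¹, ∃ hz : z ∈ D.comp 1,
        (⟨⟨z, D.comp_le_total D.group.one_mem hz⟩, hz⟩ : D.algOne) ∈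
          IsLocalRing.maximalIdeal D.algOne := by
      intro z hz
      refine Submodule.mul_induction_on hz (fun x hx y hy => ⟨hsub x hx y hy, hu x hx y hy⟩) ?_
      rintro x y ⟨hx, hx'⟩ ⟨hy, hy'⟩
      exact ⟨add_mem hx hy, add_mem hx' hy'⟩
    obtain ⟨h1, h2⟩ := key D.e (h ▸ D.e_mem)
    exact h2 (isUnit_one (M := D.algOne))

-- Each $z\in C_1$ equals $ez=x(yz)$ with $yz\in C_{\sigma^{-1}}$. This converse of
-- `exists_mul_eq_e` needs no locality.
omit [IsLocalRing D.algOne] [Finite H] in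
theorem comp_mul_comp_inv_of_mul_eq_e {σ : H ⧸ K} {x y : MonoidAlgebra R H} (hx : x ∈ D.comp σ)
    (hy : y ∈ D.comp σ⁻¹) (h : x * y = D.e) : D.comp σ * D.comp σ⁻¹ = D.comp 1 := by
  refine le_antisymm (by simpa using D.comp_mul_le σ σ⁻¹) fun z hz => ?_
  rw [← (D.mem_comp.mp hz).2.2, ← h, mul_assoc]
  refine Submodule.mul_mem_mul hx ?_
  simpa using D.mul_mem_comp hy hz

/-- If `C_1` is local, then `C` is a crossed product of `C_1` with `G[e]`. -/
theorem exists_homogeneous_unit (σ : D.group) : ∃ u v : D.Alg,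
    (u : MonoidAlgebra R H) ∈ D.comp σ ∧ (v : MonoidAlgebra R H) ∈ D.comp (σ : H ⧸ K)⁻¹ ∧
      u * v = 1 ∧ v * u = 1 := by
  obtain ⟨x, hx, y, hy, hxy⟩ := D.exists_mul_eq_e σ.2.2
  set u : D.Alg := ⟨x, D.comp_le_total σ.2 hx⟩ with hu
  set v : D.Alg := ⟨y, D.comp_le_total (inv_mem σ.2) hy⟩ with hv
  have huv : u * v = 1 := Subtype.ext hxy
  have hvu : (v * u : D.Alg) ∈ D.algOne := by
    have := D.mul_mem_comp hy hx
    rw [inv_mul_cancel] at this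
    exact this
  refine ⟨u, v, hx, hy, huv, ?_⟩
  -- As $uv=1$, the element $vu$ is an idempotent of the local ring $C_1$, so it is $0$ or $1$. It
  -- is not $0$, because $1=(uv)(uv)=u(vu)v$.
  set f : D.algOne := ⟨v * u, hvu⟩
  have hf : f * (1 - f) = 0 := by
    refine Subtype.ext ?_
    change (v * u) * (1 - v * u) = 0
    rw [mul_sub, mul_one, mul_assoc v u, ← mul_assoc u v, huv, one_mul, sub_self]
  rcases IsLocalRing.isUnit_or_isUnit_one_sub_self f with h | h
  · have h0 : 1 - f = 0 := (h.mul_right_eq_zero).mp hf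
    exact (congrArg Subtype.val (sub_eq_zero.mp h0)).symm
  · have h0 : f = 0 := (h.mul_left_eq_zero).mp hf
    have h1 : v * u = 0 := congrArg Subtype.val h0
    have h2 : (1 : D.Alg) = 0 := by
      calc (1 : D.Alg) = (u * v) * (u * v) := by rw [huv, one_mul]
        _ = u * (v * u) * v := by simp only [mul_assoc]
        _ = 0 := by rw [h1, mul_zero, zero_mul]
    exact absurd (Subtype.ext h2 : (1 : D.algOne) = 0) one_ne_zero

omit [IsLocalRing D.algOne] in
theorem mul_coe_mem_rad (x : D.Alg) {c : D.algOne} (hc : c ∈ Ring.jacobson D.algOne) :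
    x * (c : D.Alg) ∈ D.rad :=
  D.rad.mul_mem_left x (D.coe_mem_rad.mpr hc)

/-- An element of `C` lies in `C J(C_1)` if and only if all its coefficients, with respect to
homogeneous units, lie in `J(C_1)`. -/
theorem mem_rad_iff {x : D.Alg} : x ∈ D.rad ↔ ∀ σ ∈ D.group, ∀ v : D.Alg,
    (v : MonoidAlgebra R H) ∈ D.comp σ → D.proj (x * v) ∈ Ring.jacobson D.algOne := by
  refine ⟨fun hx σ _ v _ => D.proj_mem_jacobson (D.rad.mul_mem_right v hx), fun h => ?_⟩
  classical
  have := Fintype.ofFinite D.group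
  choose u v hu hv huv hvu using D.exists_homogeneous_unit
  -- Expansion of $x$ in the basis of homogeneous units $u_\sigma$: the projection of $xv_\sigma$
  -- isolates the $\sigma$-component of $x$, divided by $u_\sigma$.
  have key : ∀ x : D.Alg, x = ∑ σ, (D.proj (x * v σ) : D.Alg) * u σ := by
    refine D.alg_induction (fun τ hτ x hx => ?_) (by simp) fun x y hx hy => ?_
    · rw [Finset.sum_eq_single ⟨τ, hτ⟩]
      · have h1 : x * v ⟨τ, hτ⟩ ∈ D.algOne := by
          have := D.mul_mem_comp hx (hv ⟨τ, hτ⟩)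
          rw [mul_inv_cancel] at this
          exact this
        have h2 := congrArg Subtype.val (D.proj_coe ⟨_, h1⟩)
        change ((D.proj (x * v ⟨τ, hτ⟩) : D.algOne) : D.Alg) = _ at h2
        rw [h2, mul_assoc, hvu, mul_one]
      · intro σ _ hσ
        rw [D.proj_eq_zero (σ := τ * (σ : H ⧸ K)⁻¹) ?_ (D.mul_mem_comp hx (hv σ))]
        · simp
        · intro h
          exact hσ (Subtype.ext (mul_inv_eq_one.mp h).symm)
      · simp
    · conv_lhs => rw [hx, hy, ← Finset.sum_add_distrib]
      exact Finset.sum_congr rfl fun σ _ => by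
        rw [add_mul x y, map_add, Subalgebra.coe_add, add_mul]
  rw [key x]
  refine D.rad.sum_mem fun σ _ => ?_
  rw [D.algOne_comm (D.proj (x * v σ)).2]
  exact D.mul_coe_mem_rad _ (h _ (inv_mem σ.2) _ (hv σ))

/-- Different components of `C̄` meet in `0`. -/
theorem eq_zero_of_mem_barComp {σ τ : D.group} (hστ : σ ≠ τ) {z : D.Bar} (h1 : z ∈ D.barComp σ)
    (h2 : z ∈ D.barComp τ) : z = 0 := by
  obtain ⟨x, hx, rfl⟩ := h1
  obtain ⟨y, hy, hxy⟩ := h2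
  obtain ⟨u, v, hu, hv, huv, hvu⟩ := D.exists_homogeneous_unit σ
  rw [Ideal.Quotient.eq] at hxy
  -- Multiplication by $v$ moves $x$ to degree $1$ and $y$ to the degree $\tau\sigma^{-1}\ne1$, so
  -- the projection sees only $xv$.
  have h3 := D.proj_mem_jacobson (D.rad.mul_mem_right v hxy)
  have h4 : x * v ∈ D.algOne := by
    have := D.mul_mem_comp hx hv
    rw [mul_inv_cancel] at this
    exact this
  rw [sub_mul, map_sub, D.proj_eq_zero (σ := (τ : H ⧸ K) * (σ : H ⧸ K)⁻¹) ?_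
    (D.mul_mem_comp hy hv), zero_sub, neg_mem_iff] at h3
  · have h5 : D.proj (x * v) = ⟨x * v, h4⟩ := D.proj_coe ⟨x * v, h4⟩
    rw [h5] at h3
    have h6 := D.rad.mul_mem_right u (D.coe_mem_rad.mpr h3)
    change x * v * u ∈ D.rad at h6
    rw [mul_assoc, hvu, mul_one] at h6
    exact Ideal.Quotient.eq_zero_iff_mem.mpr h6
  · intro h
    exact hστ (Subtype.ext (mul_inv_eq_one.mp h).symm)

instance instNontrivialBarOne : Nontrivial D.BarOne :=
  Ideal.Quotient.nontrivial_iff.mpr (by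
    rw [IsLocalRing.ringJacobson_eq_maximalIdeal]
    exact Ideal.IsPrime.ne_top inferInstance)

instance instNontrivialBar : Nontrivial D.Bar := D.barIncl_injective.nontrivial

theorem degree_unique {σ τ : D.group} {u : D.Barˣ} (h1 : (u : D.Bar) ∈ D.barComp σ)
    (h2 : (u : D.Bar) ∈ D.barComp τ) : σ = τ := by
  by_contra h
  exact u.ne_zero (D.eq_zero_of_mem_barComp h h1 h2)

/-- The degree of a homogeneous unit. -/
def degree : D.hU →* D.group where
  toFun u := u.2.choose
  map_one' := D.degree_unique (u := 1) (1 : D.hU).2.choose_spec.1 ⟨1, D.e_mem, rfl⟩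
  map_mul' u v := D.degree_unique (u := u * v) (u * v : D.hU).2.choose_spec.1
    (D.mul_mem_barComp u.2.choose_spec.1 v.2.choose_spec.1)

theorem mem_barComp_degree (u : D.hU) : ((u : D.Barˣ) : D.Bar) ∈ D.barComp (D.degree u) :=
  u.2.choose_spec.1

theorem inv_mem_barComp_degree (u : D.hU) :
    (((u : D.Barˣ)⁻¹ : D.Barˣ) : D.Bar) ∈ D.barComp (D.degree u)⁻¹ :=
  u.2.choose_spec.2

omit [IsLocalRing D.algOne] in
theorem mem_barComp_one {z : D.Bar} : z ∈ D.barComp 1 ↔ ∃ c : D.BarOne, D.barIncl c = z := by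
  constructor
  · rintro ⟨x, hx, rfl⟩
    exact ⟨Ideal.Quotient.mk _ (⟨x, hx⟩ : D.algOne), rfl⟩
  · rintro ⟨c, rfl⟩
    obtain ⟨c, rfl⟩ := Ideal.Quotient.mk_surjective c
    exact ⟨c, c.2, rfl⟩

omit [IsLocalRing D.algOne] in
theorem map_barIncl_mem_hU (u : D.BarOneˣ) : Units.map (D.barIncl : D.BarOne →* D.Bar) u ∈ D.hU :=
  ⟨1, D.mem_barComp_one.mpr ⟨u, rfl⟩, by
    rw [inv_one, ← map_inv]
    exact D.mem_barComp_one.mpr ⟨(u⁻¹ : D.BarOneˣ), rfl⟩⟩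

/-- The Clifford extension `1 → C̄_1ˣ → hU(C̄) → G[e] → 1`, if `C_1` is local. -/
def cliffordExtension : GroupExtension D.BarOneˣ D.hU D.group where
  inl := (Units.map (D.barIncl : D.BarOne →* D.Bar)).codRestrict D.hU D.map_barIncl_mem_hU
  rightHom := D.degree
  inl_injective u v h := Units.ext (D.barIncl_injective
    (congrArg (fun w : D.hU => ((w : D.Barˣ) : D.Bar)) h))
  range_inl_eq_ker_rightHom := by
    ext w
    rw [MonoidHom.mem_ker, MonoidHom.mem_range]
    constructor
    · rintro ⟨u, rfl⟩
      exact D.degree_unique (D.mem_barComp_degree _) (D.mem_barComp_one.mpr ⟨u, rfl⟩)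
    · intro hw
      have h1 := D.mem_barComp_degree w
      have h2 := D.inv_mem_barComp_degree w
      rw [hw] at h1
      rw [hw, inv_one] at h2
      obtain ⟨c, hc⟩ := D.mem_barComp_one.mp h1
      obtain ⟨d, hd⟩ := D.mem_barComp_one.mp h2
      refine ⟨⟨c, d, D.barIncl_injective ?_, D.barIncl_injective ?_⟩, Subtype.ext (Units.ext hc)⟩
      · rw [map_mul, hc, hd, map_one, Units.mul_inv]
      · rw [map_mul, hc, hd, map_one, Units.inv_mul]
  rightHom_surjective σ := by
    obtain ⟨u, v, hu, hv, huv, hvu⟩ := D.exists_homogeneous_unit σ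
    let w : D.Barˣ := ⟨Ideal.Quotient.mk _ u, Ideal.Quotient.mk _ v,
      by rw [← map_mul, huv, map_one], by rw [← map_mul, hvu, map_one]⟩
    refine ⟨⟨w, σ, ⟨u, hu, rfl⟩, ⟨v, hv, rfl⟩⟩, ?_⟩
    exact D.degree_unique (u := w) (D.mem_barComp_degree _) ⟨u, hu, rfl⟩

theorem isCliffordExtension : D.IsCliffordExtension D.cliffordExtension where
  inl_eq _ := rfl
  rightHom_eq := D.mem_barComp_degree

end Local

end Datum

/-! ### Graded maps between two data -/

namespace Datum

variable {R R' : Type*} [CommRing R] [CommRing R'] {K : Subgroup H} [K.Normal]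

/-- An additive map `RH → R'H` which induces surjective maps between the components of two data, is
semilinear, and multiplicative on `F`-fixed elements. -/
structure IsGradedMap (ρ : R →+* R') (D : Datum R K) (D' : Datum R' K)
    (g : MonoidAlgebra R H →+ MonoidAlgebra R' H) : Prop where
  mem : ∀ {σ x}, x ∈ D.comp σ → g x ∈ D'.comp σ
  surj : ∀ {σ y}, y ∈ D'.comp σ → ∃ x ∈ D.comp σ, g x = y
  map_mul : ∀ {x y}, FixedBy D.F x → FixedBy D.F y → g (x * y) = g x * g y
  map_e : g D.e = D'.e
  map_smul : ∀ r x, g (r • x) = ρ r • g x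

variable [Finite H]

attribute [local instance] commRing

namespace IsGradedMap

variable {ρ : R →+* R'} {D : Datum R K} {D' : Datum R' K}
  {g : MonoidAlgebra R H →+ MonoidAlgebra R' H}

/-- The ring homomorphism `C_1 → C'_1` induced by a graded map. -/
def oneMap (h : IsGradedMap ρ D D' g) : D.algOne →+* D'.algOne where
  toFun x := ⟨⟨g (x : D.Alg), D'.comp_le_total D'.group.one_mem (h.mem x.2)⟩, h.mem x.2⟩
  map_one' := Subtype.ext (Subtype.ext h.map_e)
  map_mul' _ _ := Subtype.ext (Subtype.ext
    (h.map_mul (D.fixedBy_of_mem_total (Subtype.property _))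
      (D.fixedBy_of_mem_total (Subtype.property _))))
  map_zero' := Subtype.ext (Subtype.ext (map_zero g))
  map_add' _ _ := Subtype.ext (Subtype.ext (map_add g _ _))

theorem oneMap_surjective (h : IsGradedMap ρ D D' g) : Function.Surjective h.oneMap := fun y => by
  obtain ⟨x, hx, hxy⟩ := h.surj y.2
  exact ⟨⟨⟨x, D.comp_le_total D.group.one_mem hx⟩, hx⟩, Subtype.ext (Subtype.ext hxy)⟩

theorem isLocalRing (h : IsGradedMap ρ D D' g) [IsLocalRing D.algOne] [Nontrivial D'.algOne] :
    IsLocalRing D'.algOne :=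
  IsLocalRing.of_surjective' h.oneMap h.oneMap_surjective

theorem isLocalHom_oneMap (h : IsGradedMap ρ D D' g) [IsLocalRing D.algOne]
    [Nontrivial D'.algOne] : IsLocalHom h.oneMap :=
  IsLocalHom.of_surjective h.oneMap h.oneMap_surjective

/-- In both local rings the radical is the set of nonunits, and the surjection `oneMap` reflects
units. -/
theorem oneMap_mem_jacobson (h : IsGradedMap ρ D D' g) [IsLocalRing D.algOne]
    [IsLocalRing D'.algOne] {c : D.algOne} :
    h.oneMap c ∈ Ring.jacobson D'.algOne ↔ c ∈ Ring.jacobson D.algOne := by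
  have := h.isLocalHom_oneMap
  rw [IsLocalRing.ringJacobson_eq_maximalIdeal, IsLocalRing.ringJacobson_eq_maximalIdeal,
    IsLocalRing.mem_maximalIdeal, IsLocalRing.mem_maximalIdeal, mem_nonunits_iff, mem_nonunits_iff,
    isUnit_map_iff]

/-- The conditions `C_σ C_{σ⁻¹} = C_1` and `C'_σ C'_{σ⁻¹} = C'_1` are equivalent. -/
theorem comp_mul_comp_inv_iff (h : IsGradedMap ρ D D' g) [IsLocalRing D.algOne]
    [IsLocalRing D'.algOne] (σ : H ⧸ K) :
    D.comp σ * D.comp σ⁻¹ = D.comp 1 ↔ D'.comp σ * D'.comp σ⁻¹ = D'.comp 1 := by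
  constructor
  · intro h1
    obtain ⟨x, hx, y, hy, hxy⟩ := D.exists_mul_eq_e h1
    refine D'.comp_mul_comp_inv_of_mul_eq_e (h.mem hx) (h.mem hy) ?_
    rw [← h.map_mul (D.mem_comp.mp hx).2.1 (D.mem_comp.mp hy).2.1, hxy, h.map_e]
  · intro h1
    -- Lifts $x,y$ of the two factors have a product mapping to $1$. Hence $xy$ is a unit of $C_1$,
    -- and its inverse is absorbed into $y$.
    obtain ⟨x', hx', y', hy', hxy'⟩ := D'.exists_mul_eq_e h1
    obtain ⟨x, hx, rfl⟩ := h.surj hx'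
    obtain ⟨y, hy, rfl⟩ := h.surj hy'
    rw [← h.map_mul (D.mem_comp.mp hx).2.1 (D.mem_comp.mp hy).2.1] at hxy'
    have hmem : x * y ∈ D.comp 1 := by simpa using D.mul_mem_comp hx hy
    set c : D.algOne := ⟨⟨x * y, D.comp_le_total D.group.one_mem hmem⟩, hmem⟩
    have h2 : h.oneMap c = 1 := Subtype.ext (Subtype.ext hxy')
    have := h.isLocalHom_oneMap
    have h3 : IsUnit c := isUnit_of_map_unit h.oneMap c (h2 ▸ isUnit_one)
    obtain ⟨d, hd⟩ := h3.exists_right_inv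
    refine D.comp_mul_comp_inv_of_mul_eq_e hx (y := y * (d : D.Alg)) ?_ ?_
    · simpa using D.mul_mem_comp hy d.2
    · rw [← mul_assoc]
      exact congrArg (fun z : D.algOne => ((z : D.Alg) : MonoidAlgebra R H)) hd

/-- The ring homomorphism `C → C'` induced by a graded map. -/
def algMap (h : IsGradedMap ρ D D' g) (hG : D.group = D'.group) : D.Alg →+* D'.Alg where
  toFun x := ⟨g x, D.total_induction (p := fun x => g x ∈ D'.total)
    (fun _ hσ _ hx => D'.comp_le_total (hG ▸ hσ) (h.mem hx))
    (by rw [map_zero]; exact zero_mem _)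
    (fun _ _ hx hy => by rw [map_add]; exact add_mem hx hy) x.2⟩
  map_one' := Subtype.ext h.map_e
  map_mul' x y := Subtype.ext
    (h.map_mul (D.fixedBy_of_mem_total x.2) (D.fixedBy_of_mem_total y.2))
  map_zero' := Subtype.ext (map_zero g)
  map_add' _ _ := Subtype.ext (map_add g _ _)

variable (h : IsGradedMap ρ D D' g) (hG : D.group = D'.group)

theorem algMap_surjective : Function.Surjective (h.algMap hG) := by
  refine D'.alg_induction (fun σ hσ y hy => ?_) ⟨0, map_zero _⟩ ?_
  · obtain ⟨x, hx, hxy⟩ := h.surj hy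
    exact ⟨⟨x, D.comp_le_total (hG.symm ▸ hσ) hx⟩, Subtype.ext hxy⟩
  · rintro _ _ ⟨x, rfl⟩ ⟨y, rfl⟩
    exact ⟨x + y, _root_.map_add _ _ _⟩

theorem proj_algMap (x : D.Alg) : D'.proj (h.algMap hG x) = h.oneMap (D.proj x) := by
  revert x
  refine D.alg_induction (fun σ hσ x hx => ?_) (by simp) fun x y hx hy => ?_
  · by_cases h1 : σ = 1
    · subst h1
      have e1 : D.proj x = ⟨x, hx⟩ := D.proj_coe ⟨x, hx⟩
      rw [e1]
      exact D'.proj_coe (h.oneMap ⟨x, hx⟩)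
    · rw [D.proj_eq_zero h1 hx, D'.proj_eq_zero h1 (x := h.algMap hG x) (h.mem hx), map_zero]
  · rw [_root_.map_add, _root_.map_add, hx, hy, _root_.map_add, _root_.map_add]

/-- By `mem_rad_iff`, membership is tested on the elements $\mathrm{proj}(xv)$ of $C_1$, where
`oneMap` reflects the radical. This yields injectivity on $\bar C$ although the graded map itself
may have a kernel. -/
theorem algMap_mem_rad [IsLocalRing D.algOne] [IsLocalRing D'.algOne] {x : D.Alg} :
    h.algMap hG x ∈ D'.rad ↔ x ∈ D.rad := by
  rw [mem_rad_iff, mem_rad_iff]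
  have key : ∀ v : D.Alg, D'.proj (h.algMap hG x * h.algMap hG v) ∈ Ring.jacobson D'.algOne ↔
      D.proj (x * v) ∈ Ring.jacobson D.algOne := fun v => by
    rw [← _root_.map_mul, proj_algMap, oneMap_mem_jacobson]
  constructor
  · intro h1 σ hσ v hv
    exact (key v).mp (h1 σ (hG ▸ hσ) (h.algMap hG v) (h.mem hv))
  · intro h1 σ hσ v' hv'
    obtain ⟨v, hv, hvv⟩ := h.surj hv'
    have e : v' = h.algMap hG ⟨v, D.comp_le_total (hG.symm ▸ hσ) hv⟩ := Subtype.ext hvv.symm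
    rw [e]
    exact (key _).mpr (h1 σ (hG.symm ▸ hσ) _ hv)

/-- The isomorphism `C̄ → C̄'` induced by a graded map. -/
def barEquiv [IsLocalRing D.algOne] [IsLocalRing D'.algOne] : D.Bar ≃+* D'.Bar :=
  RingEquiv.ofBijective
    (Ideal.quotientMap D'.rad (h.algMap hG) fun _ hx => (h.algMap_mem_rad hG).mpr hx) <| by
    constructor
    · intro z w hzw
      obtain ⟨x, rfl⟩ := Ideal.Quotient.mk_surjective z
      obtain ⟨y, rfl⟩ := Ideal.Quotient.mk_surjective w
      change Ideal.Quotient.mk D'.rad (h.algMap hG x) = Ideal.Quotient.mk D'.rad (h.algMap hG y)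
        at hzw
      rw [Ideal.Quotient.eq, ← map_sub, algMap_mem_rad] at hzw
      exact Ideal.Quotient.eq.mpr hzw
    · intro z
      obtain ⟨y, rfl⟩ := Ideal.Quotient.mk_surjective z
      obtain ⟨x, rfl⟩ := h.algMap_surjective hG y
      exact ⟨Ideal.Quotient.mk _ x, rfl⟩

theorem barEquiv_mk [IsLocalRing D.algOne] [IsLocalRing D'.algOne] (x : D.Alg) :
    h.barEquiv hG (Ideal.Quotient.mk _ x) = Ideal.Quotient.mk _ (h.algMap hG x) := rfl

end IsGradedMap

/-! ### Isomorphisms of the rings $\bar C$ and of the extensions -/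

/-- An isomorphism `C̄ → C̄'` of graded rings, semilinear and compatible with the action of `N`. -/
structure IsBarIso (ρ : R →+* R') (N : Subgroup H) (D : Datum R K) (D' : Datum R' K)
    (hG : D.group = D'.group) (hN : N ≤ D.actGroup) (hN' : N ≤ D'.actGroup)
    (φ : D.Bar ≃+* D'.Bar) : Prop where
  map_algebraMap : ∀ r : R, φ (algebraMap R D.Bar r) = algebraMap R' D'.Bar (ρ r)
  image_barComp : ∀ σ : D.group, φ '' D.barComp σ = D'.barComp ⟨σ, hG ▸ σ.2⟩
  map_act : ∀ (n : H) (hn : n ∈ N) (z : D.Bar),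
    φ (D.act ⟨n, hN hn⟩ z) = D'.act ⟨n, hN' hn⟩ (φ z)

theorem IsGradedMap.isBarIso {ρ : R →+* R'} {D : Datum R K} {D' : Datum R' K}
    {g : MonoidAlgebra R H →+ MonoidAlgebra R' H} (h : IsGradedMap ρ D D' g)
    [IsLocalRing D.algOne] [IsLocalRing D'.algOne] (hG : D.group = D'.group) {N : Subgroup H}
    (hN : N ≤ D.actGroup) (hN' : N ≤ D'.actGroup)
    (hg : ∀ n ∈ N, ∀ x, FixedBy D.F x → g (conj R n x) = conj R' n (g x)) :
    IsBarIso ρ N D D' hG hN hN' (h.barEquiv hG) where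
  map_algebraMap r := by
    change h.barEquiv hG (Ideal.Quotient.mk _ (algebraMap R D.Alg r)) =
      Ideal.Quotient.mk _ (algebraMap R' D'.Alg (ρ r))
    rw [h.barEquiv_mk]
    congr 1
    rw [Algebra.algebraMap_eq_smul_one, Algebra.algebraMap_eq_smul_one]
    refine Subtype.ext ((h.map_smul r D.e).trans ?_)
    rw [h.map_e]
    rfl
  image_barComp σ := by
    ext z
    constructor
    · rintro ⟨_, ⟨x, hx, rfl⟩, rfl⟩
      exact ⟨h.algMap hG x, h.mem hx, rfl⟩
    · rintro ⟨y, hy, rfl⟩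
      obtain ⟨x, hx, hxy⟩ := h.surj hy
      refine ⟨_, ⟨⟨x, D.comp_le_total σ.2 hx⟩, hx, rfl⟩, ?_⟩
      rw [h.barEquiv_mk]
      congr 1
      exact Subtype.ext hxy
  map_act n hn z := by
    obtain ⟨x, rfl⟩ := Ideal.Quotient.mk_surjective z
    change Ideal.Quotient.mk _ (h.algMap hG (D.actAlg ⟨n, hN hn⟩ x)) =
      Ideal.Quotient.mk _ (D'.actAlg ⟨n, hN' hn⟩ (h.algMap hG x))
    congr 1
    exact Subtype.ext (hg n hn x (D.fixedBy_of_mem_total x.2))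

/-- Serves to compare $b$ with $b_1$, which are related only through their common image $\bar b$.
The relation $\rho'\circ\tau=\rho$ makes the composite $\tau$-linear. -/
theorem IsBarIso.trans_symm {R'' : Type*} [CommRing R''] {ρ : R →+* R''} {ρ' : R' →+* R''}
    {τ : R →+* R'} (hρ : ρ'.comp τ = ρ) {N : Subgroup H}
    {D : Datum R K} {D' : Datum R' K} {D'' : Datum R'' K} {hG : D.group = D''.group}
    {hG' : D'.group = D''.group} {hN : N ≤ D.actGroup} {hN' : N ≤ D'.actGroup}
    {hN'' : N ≤ D''.actGroup} {φ : D.Bar ≃+* D''.Bar} {ψ : D'.Bar ≃+* D''.Bar}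
    (hφ : IsBarIso ρ N D D'' hG hN hN'' φ) (hψ : IsBarIso ρ' N D' D'' hG' hN' hN'' ψ) :
    IsBarIso τ N D D' (hG.trans hG'.symm) hN hN' (φ.trans ψ.symm) where
  map_algebraMap r := by
    rw [RingEquiv.trans_apply, RingEquiv.symm_apply_eq, hφ.map_algebraMap, hψ.map_algebraMap, ← hρ]
    rfl
  image_barComp σ := by
    have h1 := hφ.image_barComp σ
    have h2 := hψ.image_barComp ⟨σ, (hG.trans hG'.symm) ▸ σ.2⟩
    rw [← h2] at h1
    rw [RingEquiv.coe_trans, Set.image_comp, h1, ← Set.image_comp]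
    have h3 : (ψ.symm ∘ ψ : D'.Bar → D'.Bar) = id := funext fun z => ψ.symm_apply_apply z
    rw [h3, Set.image_id]
  map_act n hn z := by
    rw [RingEquiv.trans_apply, RingEquiv.symm_apply_eq, hφ.map_act n hn, hψ.map_act n hn,
      RingEquiv.trans_apply, RingEquiv.apply_symm_apply]

theorem IsBarIso.extensionIso {ρ : R →+* R'} {N : Subgroup H} {D : Datum R K} {D' : Datum R' K}
    [IsLocalRing D.algOne] [IsLocalRing D'.algOne]
    {hG : D.group = D'.group} {hN : N ≤ D.actGroup} {hN' : N ≤ D'.actGroup}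
    {φ : D.Bar ≃+* D'.Bar} (h : IsBarIso ρ N D D' hG hN hN' φ) :
    ExtensionIso ρ N D D' D.cliffordExtension D'.cliffordExtension := by
  have hmem : ∀ (σ : D.group) (z : D.Bar), φ z ∈ D'.barComp ⟨σ, hG ▸ σ.2⟩ ↔ z ∈ D.barComp σ := by
    intro σ z
    rw [← h.image_barComp, φ.injective.mem_set_image]
  have hmap : D.hU.map (Units.mapEquiv (φ : D.Bar ≃* D'.Bar)).toMonoidHom = D'.hU := by
    ext u'
    rw [Subgroup.mem_map]
    constructor
    · rintro ⟨u, ⟨σ, h1, h2⟩, rfl⟩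
      exact ⟨⟨σ, hG ▸ σ.2⟩, (hmem _ _).mpr h1, (hmem σ⁻¹ _).mpr h2⟩
    · rintro ⟨σ, h1, h2⟩
      refine ⟨(Units.mapEquiv (φ : D.Bar ≃* D'.Bar)).symm u', ⟨⟨σ, hG.symm ▸ σ.2⟩, ?_, ?_⟩, ?_⟩
      · rw [← hmem]
        convert h1
        exact φ.apply_symm_apply _
      · rw [← hmem]
        convert h2
        exact φ.apply_symm_apply _
      · exact (Units.mapEquiv (φ : D.Bar ≃* D'.Bar)).apply_symm_apply u'
  let Φ : D.hU ≃* D'.hU :=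
    ((Units.mapEquiv (φ : D.Bar ≃* D'.Bar)).subgroupMap D.hU).trans (MulEquiv.subgroupCongr hmap)
  have hΦ : ∀ u : D.hU, (((Φ u : D'.hU) : D'.Barˣ) : D'.Bar) = φ ((u : D.Barˣ) : D.Bar) :=
    fun u => rfl
  have hdeg : ∀ u : D.hU, (D'.degree (Φ u) : H ⧸ K) = D.degree u := by
    intro u
    have h1 := (hmem _ _).mpr (D.mem_barComp_degree u)
    rw [← hΦ] at h1
    exact congrArg Subtype.val (D'.degree_unique (D'.mem_barComp_degree (Φ u)) h1)
  have hker : D.cliffordExtension.inl.range.map Φ.toMonoidHom = D'.cliffordExtension.inl.range := by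
    rw [GroupExtension.range_inl_eq_ker_rightHom, GroupExtension.range_inl_eq_ker_rightHom]
    have hone : ∀ u, u ∈ D.cliffordExtension.rightHom.ker ↔
        Φ u ∈ D'.cliffordExtension.rightHom.ker := by
      intro u
      rw [MonoidHom.mem_ker, MonoidHom.mem_ker]
      change D.degree u = 1 ↔ D'.degree (Φ u) = 1
      rw [Subtype.ext_iff, Subtype.ext_iff, hdeg]
      rfl
    ext u'
    rw [Subgroup.mem_map]
    constructor
    · rintro ⟨u, hu, rfl⟩
      exact (hone u).mp hu
    · intro hu
      obtain ⟨u, rfl⟩ := Φ.surjective u'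
      exact ⟨u, (hone u).mpr hu, rfl⟩
  -- Since `Φ` preserves degrees, it matches the kernels of the degree maps. Taking `κ` to be its
  -- restriction to them makes the left square commute by construction.
  let κ : D.BarOneˣ ≃* D'.BarOneˣ :=
    (MonoidHom.ofInjective D.cliffordExtension.inl_injective).trans
      (((Φ.subgroupMap _).trans (MulEquiv.subgroupCongr hker)).trans
        (MonoidHom.ofInjective D'.cliffordExtension.inl_injective).symm)
  refine ⟨hG, hN, hN', φ, Φ, κ, h.map_algebraMap, h.image_barComp, h.map_act, hΦ, fun u => ?_, hdeg⟩
  have h1 := (MonoidHom.ofInjective D'.cliffordExtension.inl_injective).apply_symm_apply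
    (((Φ.subgroupMap _).trans (MulEquiv.subgroupCongr hker))
      (MonoidHom.ofInjective D.cliffordExtension.inl_injective u))
  exact congrArg Subtype.val h1

end Datum

theorem FixedBy.mono {R : Type*} [CommRing R] {E F : Subgroup H} {a : MonoidAlgebra R H}
    (ha : FixedBy F a) (h : E ≤ F) : FixedBy E a := fun g hg => ha g (h hg)

theorem FixedBy.conj {R : Type*} [CommRing R] {F : Subgroup H} {a : MonoidAlgebra R H}
    (ha : FixedBy F a) {n : H} (hn : n ∈ Subgroup.normalizer (F : Set H)) :
    FixedBy F (conj R n a) := fun g hg => by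
  have h1 : n⁻¹ * g * n ∈ F := (Subgroup.mem_normalizer_iff''.mp hn g).mp hg
  conv_rhs => rw [← ha _ h1]
  rw [← conj_mul, ← conj_mul]
  congr 2
  group

theorem mem_normalizer_centralizer {P : Subgroup H} {n : H}
    (hn : n ∈ Subgroup.normalizer (P : Set H)) :
    n ∈ Subgroup.normalizer (Subgroup.centralizer (P : Set H) : Set H) := by
  have key : ∀ n ∈ Subgroup.normalizer (P : Set H), ∀ h ∈ Subgroup.centralizer (P : Set H),
      n * h * n⁻¹ ∈ Subgroup.centralizer (P : Set H) := by
    intro n hn h hh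
    rw [Subgroup.mem_centralizer_iff] at *
    intro x hx
    have h1 := hh _ ((Subgroup.mem_normalizer_iff''.mp hn x).mp hx)
    calc x * (n * h * n⁻¹) = n * (n⁻¹ * x * n * h) * n⁻¹ := by group
      _ = n * h * n⁻¹ * x := by rw [h1]; group
  rw [Subgroup.mem_normalizer_iff]
  refine fun h => ⟨key n hn h, fun h1 => ?_⟩
  simpa [mul_assoc] using key n⁻¹ (inv_mem hn) _ h1

/-! ### Relative traces -/

section RelTrace

variable [Finite H] {R : Type*} [CommRing R] {P M : Subgroup H} {x : MonoidAlgebra R H}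

omit [Finite H] in
theorem conj_mul_of_fixedBy {F : Subgroup H} (hx : FixedBy F x) (g : H) {u : H} (hu : u ∈ F) :
    conj R (g * u) x = conj R g x := by
  rw [conj_mul, hx u hu]

omit [Finite H] in
theorem conj_out_of_fixedBy (hx : FixedBy P x) (m : M) :
    conj R ((Quotient.out (m : M ⧸ P.subgroupOf M) : M) : H) x = conj R (m : H) x := by
  obtain ⟨u, hu⟩ := QuotientGroup.mk_out_eq_mul (P.subgroupOf M) m
  rw [hu, Subgroup.coe_mul, conj_mul_of_fixedBy hx _ (Subgroup.mem_subgroupOf.mp u.2)]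

/-- Left multiplication by $g$ permutes the cosets, and the chosen representatives do not matter
because $x$ is $P$-fixed. -/
theorem fixedBy_relTrace (hx : FixedBy P x) : FixedBy M (relTrace P M x) := by
  classical
  intro g hg
  have := Fintype.ofFinite (M ⧸ P.subgroupOf M)
  rw [relTrace, finsum_eq_sum_of_fintype, map_sum]
  refine Fintype.sum_equiv (MulAction.toPerm (⟨g, hg⟩ : M)) _ _ fun q => ?_
  induction q using QuotientGroup.induction_on with
  | H m =>
    change conj R g (conj R _ x) =
      conj R ((Quotient.out ((⟨g, hg⟩ * m : M) : M ⧸ P.subgroupOf M) : M) : H) x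
    rw [conj_out_of_fixedBy hx, conj_out_of_fixedBy hx, ← conj_mul, Subgroup.coe_mul]

theorem exists_coeff_ne_zero_of_relTrace {h : H} (hh : (relTrace P M x).coeff h ≠ 0) :
    ∃ m ∈ M, x.coeff (m⁻¹ * h * m) ≠ 0 := by
  classical
  have := Fintype.ofFinite (M ⧸ P.subgroupOf M)
  rw [relTrace, finsum_eq_sum_of_fintype, MonoidAlgebra.coeff_sum, Finsupp.finsetSum_apply] at hh
  obtain ⟨q, -, hq⟩ := Finset.exists_ne_zero_of_sum_ne_zero hh
  rw [coeff_conj] at hq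
  exact ⟨_, Subtype.property _, hq⟩

end RelTrace

/-! ### The Brauer homomorphism as a graded map -/

section Brauer

variable {O : Type*} [CommRing O] [IsLocalRing O] {P : Subgroup H}

theorem brauerMap_conj {n : H} (hn : n ∈ Subgroup.normalizer (P : Set H)) (a : MonoidAlgebra O H) :
    brauerMap O P (conj O n a) = conj (IsLocalRing.ResidueField O) n (brauerMap O P a) := by
  classical
  ext h
  rw [coeff_conj, coeff_brauerMap, coeff_brauerMap, coeff_conj]
  congr 1
  exact propext (Subgroup.mem_normalizer_iff''.mp (mem_normalizer_centralizer hn) h)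

theorem brauerMap_smul (r : O) (a : MonoidAlgebra O H) :
    brauerMap O P (r • a) = IsLocalRing.residue O r • brauerMap O P a := by
  classical
  ext h
  simp only [coeff_brauerMap, MonoidAlgebra.coeff_smul, Finsupp.smul_apply, smul_eq_mul, map_mul,
    mul_ite, mul_zero]

/-- Coefficients are lifted one by one, with $0$ lifted to $0$. The support does not grow, so the
lift keeps its degree and stays in $\mathcal OC_H(P)$. -/
theorem exists_brauerMap_eq [Finite H] {y : MonoidAlgebra (IsLocalRing.ResidueField O) H}
    (hy : SupportedOn (Subgroup.centralizer (P : Set H)) y) :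
    ∃ x : MonoidAlgebra O H, brauerMap O P x = y ∧ ∀ h, x.coeff h ≠ 0 → y.coeff h ≠ 0 := by
  classical
  refine ⟨MonoidAlgebra.ofCoeff (Finsupp.equivFunOnFinite.symm fun h =>
    if y.coeff h = 0 then 0 else (IsLocalRing.residue_surjective (y.coeff h)).choose), ?_, ?_⟩
  · ext h
    rw [coeff_brauerMap]
    by_cases h0 : y.coeff h = 0
    · simp [h0]
    · simp [h0, hy h h0, (IsLocalRing.residue_surjective (y.coeff h)).choose_spec]
  · intro h hh h0
    simp [h0] at hh

theorem fixedBy_of_supportedOn_centralizer {R : Type*} [CommRing R] {x : MonoidAlgebra R H}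
    (hx : SupportedOn (Subgroup.centralizer (P : Set H)) x) : FixedBy P x := by
  intro g hg
  have key : ∀ h, h ∈ Subgroup.centralizer (P : Set H) → g⁻¹ * h * g = h := fun h hh => by
    rw [mul_assoc, ← Subgroup.mem_centralizer_iff.mp hh g hg, inv_mul_cancel_left]
  have hg' : ∀ h, g⁻¹ * h * g ∈ Subgroup.centralizer (P : Set H) →
      h ∈ Subgroup.centralizer (P : Set H) := fun h hh =>
    (Subgroup.mem_normalizer_iff''.mp (mem_normalizer_centralizer
      (Subgroup.le_normalizer hg)) h).mpr hh
  ext h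
  rw [coeff_conj]
  by_cases hh : h ∈ Subgroup.centralizer (P : Set H)
  · rw [key h hh]
  · have h1 : x.coeff h = 0 := by_contra fun h2 => hh (hx h h2)
    have h2 : x.coeff (g⁻¹ * h * g) = 0 := by_contra fun h2 => hh (hg' h (hx _ h2))
    rw [h1, h2]

variable [Finite H] {p : ℕ} [Fact p.Prime] [CharP (IsLocalRing.ResidueField O) p]

/-- The Brauer homomorphism takes a relative trace to a sum over the cosets normalizing `P`. -/
theorem brauerMap_relTrace (hP : IsPGroup p P) {M : Subgroup H} (hPM : P ≤ M) :
    ∃ (t : Finset (M ⧸ P.subgroupOf M)),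
      (∀ q ∈ t, ((Quotient.out q : M) : H) ∈ Subgroup.normalizer (P : Set H)) ∧
      ∀ x : MonoidAlgebra O H, FixedBy P x → brauerMap O P (relTrace P M x) =
        ∑ q ∈ t, conj (IsLocalRing.ResidueField O) ((Quotient.out q : M) : H) (brauerMap O P x) := by
  classical
  have := Fintype.ofFinite (M ⧸ P.subgroupOf M)
  -- Under left multiplication by $P$, a coset $mP$ is fixed exactly when $m^{-1}Pm\subseteq P$; as
  -- $P$ is finite, $m$ then normalizes $P$. At $z\in C_H(P)$ the summands are constant on orbits,
  -- so in characteristic $p$ only fixed cosets count.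
  let := MulAction.compHom (M ⧸ P.subgroupOf M) (Subgroup.inclusion hPM)
  have hsmul : ∀ (u : P) (m : M), u • (m : M ⧸ P.subgroupOf M) =
      ((Subgroup.inclusion hPM u * m : M) : M ⧸ P.subgroupOf M) := fun _ _ => rfl
  have hn : ∀ q ∈ Finset.univ.filter (· ∈ MulAction.fixedPoints P (M ⧸ P.subgroupOf M)),
      ((Quotient.out q : M) : H) ∈ Subgroup.normalizer (P : Set H) := by
    intro q hq
    rw [← inv_mem_iff]
    refine Subgroup.mem_normalizer_fintype (S := (P : Set H)) fun u hu => ?_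
    have h1 := (Finset.mem_filter.mp hq).2 ⟨u⁻¹, inv_mem hu⟩
    rw [← QuotientGroup.out_eq' q, hsmul, QuotientGroup.eq, Subgroup.mem_subgroupOf] at h1
    simpa [mul_assoc] using h1
  refine ⟨_, hn, fun x hx => ?_⟩
  ext z
  rw [MonoidAlgebra.coeff_sum, Finsupp.finsetSum_apply, coeff_brauerMap]
  split_ifs with hz
  · rw [relTrace, finsum_eq_sum_of_fintype, MonoidAlgebra.coeff_sum, Finsupp.finsetSum_apply,
      map_sum, sum_eq_sum_fixedPoints hP]
    · refine Finset.sum_congr rfl fun q hq => ?_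
      rw [← brauerMap_conj (hn q hq), coeff_brauerMap, if_pos hz]
    · intro u q
      induction q using QuotientGroup.induction_on with
      | H m =>
        rw [hsmul, conj_out_of_fixedBy hx, conj_out_of_fixedBy hx, Subgroup.coe_mul,
          Subgroup.coe_inclusion, conj_mul, coeff_conj]
        congr 2
        rw [mul_assoc, ← Subgroup.mem_centralizer_iff.mp hz u u.2, inv_mul_cancel_left]
  · symm
    refine Finset.sum_eq_zero fun q hq => ?_
    rw [← brauerMap_conj (hn q hq), coeff_brauerMap, if_neg hz]

variable {K : Subgroup H} [K.Normal]

/-- The Brauer homomorphism induces surjective maps from the components of the datum of a block `e`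
of `OM` to the components of the datum of `b̄`. -/
theorem isGradedMap_brauerMap {b : MonoidAlgebra O H} (hb : IsBlock K b)
    (hP : IsDefectGroup p K P b) {L M : Subgroup H} (hM : L ⊓ K = M) {e : MonoidAlgebra O H}
    (he : IsBlock M e) (hD : IsDefectGroup p M P e) (hL : Subgroup.centralizer (P : Set H) ≤ L)
    (hn : normIn K P ≤ M) (heb : brauerMap O P e = brauerMap O P b) :
    Datum.IsGradedMap (IsLocalRing.residue O) (blockDatum L M hM e he) (brauerDatum K P b hb hP)
      (brauerMap O P) where
  mem {σ x} hx := by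
    classical
    rw [Datum.mem_comp] at *
    obtain ⟨h1, h2, h3⟩ := hx
    have h2' : FixedBy M x := h2
    have h3' : e * x = x := h3
    refine ⟨fun h hh => ?_, FixedBy.brauerMap (h2'.mono hn) inf_le_left, ?_⟩
    · rw [coeff_brauerMap] at hh
      split_ifs at hh with hc
      · exact ⟨hc, (h1 h fun h0 => hh (by rw [h0, map_zero])).2⟩
      · exact absurd rfl hh
    · change brauerMap O P b * _ = _
      rw [← heb, ← brauerMap_mul hD.isPGroup (he.fixedBy.mono hD.le) (h2'.mono hD.le), h3']
  surj {σ y} hy := by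
    rw [Datum.mem_comp] at hy
    obtain ⟨h1, h2, h3⟩ := hy
    have h2' : FixedBy (normIn K P) y := h2
    have h3' : brauerMap O P b * y = y := h3
    have hyc : SupportedOn (Subgroup.centralizer (P : Set H)) y := fun h hh => (h1 h hh).1
    obtain ⟨x, hxy, hx⟩ := exists_brauerMap_eq hyc
    have hxP : FixedBy P x :=
      fixedBy_of_supportedOn_centralizer fun h hh => hyc h (hx h hh)
    obtain ⟨a, haM, haP, hae⟩ := hD.mem_trace
    have haxP := haP.mul hxP
    have htr := fixedBy_relTrace (M := M) haxP
    -- With $e=\mathrm{Tr}_P^M(a)$, the surviving coset representatives lie in $N_K(P)$ and fix $y$,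
    -- so $y$ factors out of the sum. The image is $\bar
    -- b\cdot\mathrm{Br}_P(\mathrm{Tr}_P^M(a))\cdot y=\bar b\,\bar b\,y=y$.
    refine ⟨e * relTrace P M (a * x), (Datum.mem_comp _).mpr ⟨fun h hh => ?_, ?_, ?_⟩, ?_⟩
    · obtain ⟨u, v, hu, hv, rfl⟩ := exists_coeff_ne_zero_of_mul hh
      obtain ⟨m, hm, hv⟩ := exists_coeff_ne_zero_of_relTrace hv
      obtain ⟨c, d, hc, hd, hcd⟩ := exists_coeff_ne_zero_of_mul hv
      have hu' := he.supported u hu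
      have hc' := haM c hc
      have hd' := h1 d (hx d hd)
      have hML : M ≤ L := hM ▸ inf_le_left
      have hMK : M ≤ K := hM ▸ inf_le_right
      have hv' : v = m * (c * d) * m⁻¹ := by rw [hcd]; group
      have h1' : ∀ w ∈ M, (w : H ⧸ K) = 1 := fun w hw =>
        (QuotientGroup.eq_one_iff w).mpr (hMK hw)
      refine ⟨?_, ?_⟩
      · rw [hv']
        exact L.mul_mem (hML hu') (L.mul_mem (L.mul_mem (hML hm)
          (L.mul_mem (hML hc') (hL hd'.1))) (L.inv_mem (hML hm)))
      · rw [hv']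
        simp only [QuotientGroup.mk_mul, QuotientGroup.mk_inv]
        rw [h1' u hu', h1' m hm, h1' c hc', hd'.2]
        simp
    · exact he.fixedBy.mul htr
    · change e * (e * _) = e * _
      rw [← mul_assoc, he.idem]
    · obtain ⟨t, ht, htr'⟩ := brauerMap_relTrace (O := O) hD.isPGroup hD.le
      rw [brauerMap_mul hD.isPGroup (he.fixedBy.mono hD.le) (htr.mono hD.le), htr' _ haxP,
        brauerMap_mul hD.isPGroup haP hxP, hxy]
      have h4 : ∑ q ∈ t, conj (IsLocalRing.ResidueField O) ((Quotient.out q : M) : H)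
            (brauerMap O P a * y) =
          (∑ q ∈ t, conj (IsLocalRing.ResidueField O) ((Quotient.out q : M) : H)
            (brauerMap O P a)) * y := by
        rw [Finset.sum_mul]
        refine Finset.sum_congr rfl fun q hq => ?_
        rw [map_mul, h2' _ ⟨ht q hq, (hM ▸ inf_le_right : M ≤ K) (Subtype.property _)⟩]
      rw [h4, ← htr' _ haP, hae, heb, h3', h3']
  map_mul hx hy := by
    have hx' : FixedBy M _ := hx
    have hy' : FixedBy M _ := hy
    exact brauerMap_mul hD.isPGroup (hx'.mono hD.le) (hy'.mono hD.le)
  map_e := heb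
  map_smul := brauerMap_smul

end Brauer

/-! ### Locality of $C_1$ over a complete ring -/

section Complete

variable {R : Type*} [CommRing R] {K : Subgroup H} [K.Normal] [Finite H]

attribute [local instance] Datum.commRing

theorem Datum.finite_algOne [IsNoetherianRing R] (D : Datum R K) : Module.Finite R D.algOne := by
  have h1 : IsNoetherian R (MonoidAlgebra R H) :=
    isNoetherian_of_linearEquiv (MonoidAlgebra.coeffLinearEquiv R).symm
  let i : D.algOne →ₗ[R] MonoidAlgebra R H :=
    { toFun := fun x => x.1.1, map_add' := fun _ _ => rfl, map_smul' := fun _ _ => rfl }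
  have h2 : IsNoetherian R D.algOne := isNoetherian_of_injective i fun x y h =>
    Subtype.ext (Subtype.ext h)
  infer_instance

theorem Datum.nontrivial_algOne {D : Datum R K} (h : D.e ≠ 0) : Nontrivial D.algOne :=
  ⟨⟨1, 0, fun h1 => h (congrArg (fun z : D.algOne => ((z : D.Alg) : MonoidAlgebra R H)) h1)⟩⟩

/-- If `O` is complete, then `bZ(OM)` is local for each block `b` of `OM`. -/
theorem isLocalRing_algOne_of_isAdicComplete [IsLocalRing R] [IsNoetherianRing R]
    [IsAdicComplete (IsLocalRing.maximalIdeal R) R] {L M : Subgroup H} (hM : L ⊓ K = M)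
    {e : MonoidAlgebra R H} (he : IsBlock M e) : IsLocalRing (blockDatum L M hM e he).algOne := by
  have := (blockDatum L M hM e he).finite_algOne
  have := Datum.nontrivial_algOne (D := blockDatum L M hM e he) he.ne_zero
  refine isLocalRing_of_finite_of_isAdicComplete (O := R) _ fun a ha => ?_
  obtain ⟨h1, h2, h3⟩ := (Datum.mem_comp _).mp a.2
  have h4 : SupportedOn M (a : (blockDatum L M hM e he).Alg).1 := fun h hh =>
    hM ▸ ⟨(h1 h hh).1, (QuotientGroup.eq_one_iff h).mp (h1 h hh).2⟩
  rcases he.primitive _ h4 (fun c hc => (SupportedOn.commute hc h2).symm)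
    (congrArg (fun z : (blockDatum L M hM e he).algOne =>
      ((z : (blockDatum L M hM e he).Alg) : MonoidAlgebra R H)) ha) h3 with h | h
  · exact Or.inl (Subtype.ext (Subtype.ext h))
  · exact Or.inr (Subtype.ext (Subtype.ext h))

end Complete

/-! ### Lifting locality along the Brauer homomorphism -/

section Radical

variable [Finite H] {p : ℕ} [Fact p.Prime] {P : Subgroup H}

attribute [local instance] Datum.commRing

/-- A `p`-group acting on a nonzero abelian group of exponent `p` has a nonzero fixed point. -/
theorem exists_smul_eq_self_ne_zero {G W : Type*} [Group G] [Finite G] [AddCommGroup W]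
    [DistribMulAction G W] (hG : IsPGroup p G) (hp : ∀ w : W, p • w = 0) {v : W} (hv : v ≠ 0) :
    ∃ w : W, w ≠ 0 ∧ ∀ g : G, g • w = w := by
  -- The span of one orbit over the prime field is finite even when $W$ is not, so $k$ may have any
  -- size. Its order is divisible by $p$ and $0$ is fixed, hence there is another fixed point.
  let A : AddSubgroup W := AddSubgroup.closure (Set.range fun g : G => g • v)
  have hA : ∀ g : G, ∀ a ∈ A, g • a ∈ A := by
    intro g a ha
    refine AddSubgroup.closure_induction (p := fun a _ => g • a ∈ A) ?_ ?_ ?_ ?_ ha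
    · rintro _ ⟨g', rfl⟩
      exact AddSubgroup.subset_closure ⟨g * g', mul_smul g g' v⟩
    · rw [smul_zero]
      exact zero_mem _
    · intro x y _ _ hx hy
      rw [smul_add]
      exact add_mem hx hy
    · intro x _ hx
      rw [smul_neg]
      exact neg_mem hx
  have hvA : v ∈ A := AddSubgroup.subset_closure ⟨1, one_smul G v⟩
  have hfg : AddGroup.FG A := AddGroup.closure_finite_fg _
  have hfin : Finite A := AddCommGroup.finite_of_fg_isAddTorsion A fun a =>
    isOfFinAddOrder_iff_nsmul_eq_zero.mpr ⟨p, (Fact.out : p.Prime).pos, Subtype.ext (hp a)⟩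
  let : MulAction G A :=
    { smul := fun g a => ⟨g • (a : W), hA g a a.2⟩
      one_smul := fun a => Subtype.ext (one_smul G (a : W))
      mul_smul := fun g h a => Subtype.ext (mul_smul g h (a : W)) }
  have hdvd : p ∣ Nat.card A := by
    have h1 : addOrderOf (⟨v, hvA⟩ : A) = p :=
      addOrderOf_eq_prime (Subtype.ext (hp v)) fun h => hv (congrArg Subtype.val h)
    rw [← h1]
    exact addOrderOf_dvd_natCard _
  obtain ⟨w, hw, hw0⟩ := hG.exists_fixed_point_of_prime_dvd_card_of_fixed_point A hdvd (a := 0)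
    fun g => Subtype.ext (smul_zero g)
  exact ⟨w, fun h => hw0 (Subtype.ext h.symm), fun g => congrArg Subtype.val (hw g)⟩

/-- A nonzero subspace on which a `p`-group acts by left multiplication, in characteristic `p`,
contains a nonzero fixed point. -/
theorem exists_fixed_ne_zero {k : Type*} [CommRing k] [CharP k p] (hP : IsPGroup p P)
    (V : AddSubgroup (MonoidAlgebra k H))
    (hV : ∀ u ∈ P, ∀ v ∈ V, MonoidAlgebra.single u 1 * v ∈ V) {v : MonoidAlgebra k H} (hv : v ∈ V)
    (hv0 : v ≠ 0) : ∃ w ∈ V, w ≠ 0 ∧ ∀ u ∈ P, MonoidAlgebra.single u 1 * w = w := by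
  let : DistribMulAction P V :=
    { smul := fun u a => ⟨MonoidAlgebra.single (u : H) 1 * (a : MonoidAlgebra k H),
        hV u u.2 a a.2⟩
      one_smul := fun a => Subtype.ext (one_mul (a : MonoidAlgebra k H))
      mul_smul := fun u u' a => Subtype.ext (by
        change MonoidAlgebra.single ((u : H) * u') (1 : k) * (a : MonoidAlgebra k H) =
          MonoidAlgebra.single (u : H) 1 * (MonoidAlgebra.single (u' : H) 1 * _)
        rw [← mul_assoc, MonoidAlgebra.single_mul_single, one_mul])
      smul_zero := fun u => Subtype.ext (mul_zero _)
      smul_add := fun u a c => Subtype.ext (mul_add _ _ _) }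
  obtain ⟨w, hw0, hw⟩ := exists_smul_eq_self_ne_zero (W := V) (v := ⟨v, hv⟩) hP
    (fun w => Subtype.ext (by
      change p • (w : MonoidAlgebra k H) = 0
      rw [← Nat.cast_smul_eq_nsmul k, CharP.cast_eq_zero, zero_smul]))
    fun h => hv0 (congrArg Subtype.val h)
  exact ⟨w, w.2, fun h => hw0 (Subtype.ext h), fun u hu => congrArg Subtype.val (hw ⟨u, hu⟩)⟩

/-- An element of `(kN_H(P))^P` without coefficients on `C_H(P)` annihilates the elements which are
fixed by left multiplication with `P`. -/
theorem mul_eq_zero_of_fixed {k : Type*} [CommRing k] [CharP k p] (hP : IsPGroup p P)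
    {x v : MonoidAlgebra k H} (hxN : SupportedOn (Subgroup.normalizer (P : Set H)) x)
    (hxP : FixedBy P x) (hxC : ∀ h ∈ Subgroup.centralizer (P : Set H), x.coeff h = 0)
    (hv : ∀ u ∈ P, MonoidAlgebra.single u 1 * v = v) : x * v = 0 := by
  classical
  have := Fintype.ofFinite H
  have hv' : ∀ u ∈ P, ∀ z, v.coeff (u * z) = v.coeff z := fun u hu z => by
    conv_lhs => rw [← hv u hu]
    rw [MonoidAlgebra.coeff_single_mul_apply, one_mul, inv_mul_cancel_left]
  -- The terms $x_hv_{h^{-1}z}$ of the convolution are constant on $P$-conjugacy orbits, because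
  -- $x_h\ne0$ forces $h$ to normalize $P$ and $v$ is invariant under $P$. The fixed points lie in
  -- $C_H(P)$, where $x$ vanishes.
  let : MulAction P H := MulAction.compHom H (MulAut.conj.comp P.subtype)
  have smul_def : ∀ (g : P) (h : H), g • h = (g : H) * h * (g : H)⁻¹ := fun g h => rfl
  ext z
  rw [MonoidAlgebra.coeff_mul_apply_left, Finsupp.sum_fintype _ _ (by simp),
    sum_eq_sum_fixedPoints hP]
  · refine Finset.sum_eq_zero fun h hh => ?_
    rw [hxC h, zero_mul]
    rw [Subgroup.mem_centralizer_iff]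
    intro u hu
    have := (Finset.mem_filter.mp hh).2 ⟨u, hu⟩
    exact mul_inv_eq_iff_eq_mul.mp this
  · intro u h
    rw [smul_def, coeff_eq_of_fixedBy hxP u.2]
    by_cases h0 : x.coeff h = 0
    · rw [h0, zero_mul, zero_mul]
    · have h1 : h⁻¹ * (u : H)⁻¹ * h ∈ P :=
        (Subgroup.mem_normalizer_iff''.mp (hxN h h0) _).mp (inv_mem u.2)
      congr 1
      have h2 : ((u : H) * h * (u : H)⁻¹)⁻¹ * z =
          (u : H) * ((h⁻¹ * (u : H)⁻¹ * h) * (h⁻¹ * z)) := by group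
      rw [h2, hv' _ u.2, hv' _ h1]

variable {O : Type*} [CommRing O] [IsLocalRing O] [CharP (IsLocalRing.ResidueField O) p]

/-- If `Br_P(x) = 0`, for `x ∈ (ON_H(P))^P`, then left multiplication with `1 - x` is bijective. -/
theorem bijective_one_sub_mul [IsNoetherianRing O] (hP : IsPGroup p P) {x : MonoidAlgebra O H}
    (hxN : SupportedOn (Subgroup.normalizer (P : Set H)) x) (hxP : FixedBy P x)
    (hx : brauerMap O P x = 0) : Function.Bijective (LinearMap.mulLeft O (1 - x)) := by
  classical
  set k := IsLocalRing.ResidueField O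
  set r : MonoidAlgebra O H →+* MonoidAlgebra k H :=
    MonoidAlgebra.mapRingHom H (IsLocalRing.residue O) with hr
  have hrc : ∀ (a : MonoidAlgebra O H) (h : H),
      (r a).coeff h = IsLocalRing.residue O (a.coeff h) := fun a h => by simp [hr]
  have hconj : ∀ (a : MonoidAlgebra O H) (g : H), r (conj O g a) = conj k g (r a) := fun a g => by
    ext h
    rw [hrc, coeff_conj, coeff_conj, hrc]
  have hxP' : FixedBy P (r x) := fun g hg => by rw [← hconj, hxP g hg]
  -- Since $\bar x$ commutes with $P$, the kernel is stable under left multiplication by $P$. If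
  -- nonzero, it would contain a $P$-fixed $w\ne0$; but $\bar xw=0$ then gives $w=(1-\bar x)w=0$.
  have hinj : Function.Injective (LinearMap.mulLeft k (1 - r x)) := by
    rw [injective_iff_map_eq_zero]
    intro v hv
    by_contra hv0
    obtain ⟨w, hw, hw0, hwP⟩ := exists_fixed_ne_zero hP
      (LinearMap.ker (LinearMap.mulLeft k (1 - r x))).toAddSubgroup (fun u hu v hv => by
        change (1 - r x) * (MonoidAlgebra.single u 1 * v) = 0
        have hv' : (1 - r x) * v = 0 := hv
        have h1 : (1 - r x) * MonoidAlgebra.single u 1 =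
            MonoidAlgebra.single u 1 * (1 - r x) := by
          rw [single_mul_eq, map_sub, map_one, hxP' u hu]
        rw [← mul_assoc, h1, mul_assoc, hv', mul_zero]) hv hv0
    have hw' : (1 - r x) * w = 0 := hw
    refine hw0 ?_
    rw [sub_mul, one_mul, mul_eq_zero_of_fixed hP (fun h hh => hxN h fun h0 => hh ?_) hxP' ?_ hwP,
      sub_zero] at hw'
    · exact hw'
    · intro h hh
      have h1 := congrArg (fun a => MonoidAlgebra.coeff a h) hx
      simp only [coeff_brauerMap, if_pos hh] at h1
      rw [hrc, h1]
      simp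
    · rw [hrc, h0, map_zero]
  have : Module.Finite k (MonoidAlgebra k H) :=
    Module.Finite.equiv (MonoidAlgebra.coeffLinearEquiv k).symm
  have hsurj := LinearMap.injective_iff_surjective.mp hinj
  have hnoeth : IsNoetherian O (MonoidAlgebra O H) :=
    isNoetherian_of_linearEquiv (MonoidAlgebra.coeffLinearEquiv O).symm
  -- Over $k$, injectivity gives surjectivity by finite dimension. Nakayama's lemma lifts
  -- surjectivity to $\mathcal O$, and the Noetherian property returns injectivity.
  refine IsNoetherian.bijective_of_surjective_endomorphism _ ?_
  rw [← LinearMap.range_eq_top, eq_top_iff]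
  refine Submodule.le_of_le_smul_of_le_jacobson_bot (I := IsLocalRing.maximalIdeal O)
    (IsNoetherian.noetherian _) (IsLocalRing.maximalIdeal_le_jacobson _) fun z _ => ?_
  obtain ⟨w', hw'⟩ := hsurj (r z)
  obtain ⟨w, rfl⟩ : ∃ w, r w = w' := by
    have := Fintype.ofFinite H
    refine ⟨MonoidAlgebra.ofCoeff (Finsupp.equivFunOnFinite.symm fun h =>
      (IsLocalRing.residue_surjective (w'.coeff h)).choose), ?_⟩
    ext h
    rw [hrc]
    simpa using (IsLocalRing.residue_surjective (w'.coeff h)).choose_spec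
  rw [← add_sub_cancel ((1 - x) * w) z]
  refine Submodule.add_mem_sup ⟨w, rfl⟩ ?_
  have h0 : r (z - (1 - x) * w) = 0 := by
    rw [map_sub, map_mul, map_sub, map_one, sub_eq_zero]
    exact hw'.symm
  generalize z - (1 - x) * w = c at h0
  rw [← MonoidAlgebra.sum_coeff_single c]
  refine Submodule.sum_mem _ fun h _ => ?_
  have h1 : c.coeff h ∈ IsLocalRing.maximalIdeal O := by
    rw [← IsLocalRing.residue_eq_zero_iff, ← hrc, h0]
    rfl
  have h2 : (MonoidAlgebra.single h (c.coeff h) : MonoidAlgebra O H) =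
      c.coeff h • MonoidAlgebra.single h 1 := by
    rw [MonoidAlgebra.smul_single, smul_eq_mul, mul_one]
  rw [h2]
  exact Submodule.smul_mem_smul h1 trivial

variable {K : Subgroup H} [K.Normal]

/-- For a block `b₁` of `ON_K(P)`, the ring `b₁Z(ON_K(P))` is local if its image under `Br_P` is. -/
theorem isLocalRing_algOne_of_isGradedMap [IsNoetherianRing O] (hP : IsPGroup p P)
    {e : MonoidAlgebra O H} (he : IsBlock (normIn K P) e) (hPK : P ≤ normIn K P)
    {D : Datum (IsLocalRing.ResidueField O) K} [IsLocalRing D.algOne]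
    (h : Datum.IsGradedMap (IsLocalRing.residue O)
      (blockDatum (Subgroup.normalizer (P : Set H)) (normIn K P) rfl e he) D (brauerMap O P)) :
    IsLocalRing
      (blockDatum (Subgroup.normalizer (P : Set H)) (normIn K P) rfl e he).algOne := by
  set E := blockDatum (Subgroup.normalizer (P : Set H)) (normIn K P) rfl e he with hE
  have : IsLocalHom h.oneMap := by
    constructor
    intro c hc
    obtain ⟨d', hd'⟩ := hc.exists_right_inv
    obtain ⟨d, rfl⟩ := h.oneMap_surjective d'
    rw [← map_mul] at hd'
    -- It remains to invert an element $z$ with $\mathrm{Br}_P(z)=\mathrm{Br}_P(e)$. For this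
    -- $1-(e-z)$ is inverted in $\mathcal OH$, and the inverse is multiplied by $e$.
    suffices h1 : ∃ w, c * d * w = 1 by
      obtain ⟨w, hw⟩ := h1
      exact IsUnit.of_mul_eq_one (d * w) (by rw [← mul_assoc, hw])
    generalize c * d = y at hd'
    obtain ⟨h1, h2, h3⟩ := (Datum.mem_comp _).mp y.2
    set z : MonoidAlgebra O H := y.1.1 with hz
    have hy : brauerMap O P z = brauerMap O P e :=
      Eq.trans (b := D.e) (congrArg (fun a : D.algOne => a.1.1) hd') h.map_e.symm
    have hzF : FixedBy (normIn K P) z := h2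
    have hzS : SupportedOn (normIn K P) z := fun g hg =>
      ⟨(h1 g hg).1, (QuotientGroup.eq_one_iff g).mp (h1 g hg).2⟩
    have hez : e * z = z := h3
    obtain ⟨w, hw, hwS, hwF⟩ : ∃ w : MonoidAlgebra O H, (1 - (e - z)) * w = 1 ∧
        SupportedOn (normIn K P) w ∧ FixedBy (normIn K P) w := by
      have hxS : SupportedOn (normIn K P) (1 - (e - z)) := by
        intro g hg
        by_contra h5
        have h6 : e.coeff g = 0 := by_contra fun h7 => h5 (he.supported g h7)
        have h7 : z.coeff g = 0 := by_contra fun h7 => h5 (hzS g h7)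
        have h8 : (1 : MonoidAlgebra O H).coeff g = 0 := by_contra fun h9 =>
          h5 (supportedOn_single (one_mem _) (1 : O) g h9)
        exact hg (by simp [h6, h7, h8])
      have hxF : FixedBy (normIn K P) (e - z) := fun g hg => by
        rw [map_sub, he.fixedBy g hg, hzF g hg]
      obtain ⟨hinj, hsurj⟩ := bijective_one_sub_mul hP (x := e - z) (fun g hg => by
        by_cases h0 : e.coeff g = 0
        · exact (h1 g fun h4 => hg (by simp [h0, h4])).1
        · exact (he.supported g h0).1) (hxF.mono hPK) (by rw [map_sub, hy, sub_self])
      obtain ⟨w, hw⟩ := hsurj 1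
      have hw' : (1 - (e - z)) * w = 1 := hw
      -- Uniqueness places the inverse in $(\mathcal ON_K(P))^{N_K(P)}$: its restriction to $N_K(P)$
      -- and its conjugates under $N_K(P)$ solve the same equation.
      have huniq : ∀ w', (1 - (e - z)) * w' = 1 → w' = w := fun w' h4 =>
        hinj (h4.trans hw'.symm)
      refine ⟨w, hw', ?_, fun g hg => huniq _ ?_⟩
      · rw [← huniq (restrict O (normIn K P) w) ?_]
        · exact supportedOn_restrict _ _
        · rw [← mul_restrict w hxS, hw', MonoidAlgebra.one_def]
          exact restrict_eq_self (supportedOn_single (one_mem _) 1)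
      · have h4 := congrArg (conj O g) hw'
        rwa [map_mul, map_sub, hxF g hg, map_one] at h4
    have hze : z * e = z := by
      rw [← SupportedOn.commute he.supported hzF, hez]
    have hwe : e * w ∈ E.comp 1 := (Datum.mem_comp _).mpr
      ⟨fun g hg => by
        have := he.supported.mul hwS g hg
        exact ⟨this.1, (QuotientGroup.eq_one_iff g).mpr this.2⟩, he.fixedBy.mul hwF, by
        change e * (e * w) = e * w
        rw [← mul_assoc, he.idem]⟩
    refine ⟨⟨⟨e * w, E.comp_le_total E.group.one_mem hwe⟩, hwe⟩, Subtype.ext (Subtype.ext ?_)⟩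
    change z * (e * w) = e
    have h4 := congrArg (e * ·) hw
    simp only [← mul_assoc, mul_sub, mul_one, he.idem, hez, sub_sub_cancel] at h4
    rw [← mul_assoc, hze, h4]
  exact h.oneMap.domain_isLocalRing

end Radical

/-! ### Conjugates of blocks and their orthogonality -/

section Conj

variable {R : Type*} [CommRing R]

theorem SupportedOn.conj {M : Subgroup H} {a : MonoidAlgebra R H} (ha : SupportedOn M a) {n : H}
    (hn : n ∈ Subgroup.normalizer (M : Set H)) : SupportedOn M (conj R n a) := fun h hh => by
  rw [coeff_conj] at hh
  exact (Subgroup.mem_normalizer_iff''.mp hn h).mpr (ha _ hh)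

theorem IsBlock.conj {M : Subgroup H} {e : MonoidAlgebra R H} (he : IsBlock M e) {n : H}
    (hn : n ∈ Subgroup.normalizer (M : Set H)) : IsBlock M (conj R n e) where
  supported := he.supported.conj hn
  central a ha := by
    have h := congrArg (BlockClifford.conj R n) (he.central _ (ha.conj (inv_mem hn)))
    rwa [map_mul, map_mul, conj_conj_inv] at h
  idem := by rw [← map_mul, he.idem]
  ne_zero h := he.ne_zero ((map_eq_zero_iff _ (BlockClifford.conj R n).injective).mp h)
  primitive f hf hfc hff hef := by
    have h := he.primitive (BlockClifford.conj R n⁻¹ f) (hf.conj (inv_mem hn)) (fun a ha => by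
      have h := congrArg (BlockClifford.conj R n⁻¹) (hfc _ (ha.conj hn))
      rwa [map_mul, map_mul, conj_inv_conj] at h) (by rw [← map_mul, hff]) (by
      have h := congrArg (BlockClifford.conj R n⁻¹) hef
      rwa [map_mul, conj_inv_conj] at h)
    rcases h with h | h
    · exact Or.inl ((map_eq_zero_iff _ (BlockClifford.conj R n⁻¹).injective).mp h)
    · exact Or.inr (by rw [← h, conj_conj_inv])

/-- Two blocks whose product is not zero are equal. -/
theorem IsBlock.eq_of_mul_ne_zero {M : Subgroup H} {e f : MonoidAlgebra R H} (he : IsBlock M e)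
    (hf : IsBlock M f) (h : e * f ≠ 0) : e = f := by
  have hc : ∀ a, SupportedOn M a → e * f * a = a * (e * f) := fun a ha => by
    rw [mul_assoc, hf.central a ha, ← mul_assoc, he.central a ha, mul_assoc]
  have hef : e * f = f * e := he.central f hf.supported
  have hs := he.supported.mul hf.supported
  have hi : e * f * (e * f) = e * f := by
    rw [mul_assoc, ← mul_assoc f, ← hef, mul_assoc e f f, hf.idem, ← mul_assoc, he.idem]
  have h1 := (he.primitive _ hs hc hi (by rw [← mul_assoc, he.idem])).resolve_left h
  have h2 := (hf.primitive _ hs hc hi (by rw [hef, ← mul_assoc, hf.idem])).resolve_left h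
  exact h1.symm.trans h2

end Conj

/-! ### Stabilizers of $b$, $b_1$ and $\bar b$ -/

section Stabilizers

variable [Finite H] {p : ℕ} [Fact p.Prime] {O : Type*} [CommRing O] [IsLocalRing O]
  [CharP (IsLocalRing.ResidueField O) p] {K P : Subgroup H}

/-- An element which normalizes `P` and `M` stabilizes a block of `OM` with defect group `P` if and
only if it stabilizes the image of the block under the Brauer homomorphism. -/
theorem conj_eq_self_iff_brauerMap {M : Subgroup H} {e : MonoidAlgebra O H} (he : IsBlock M e)
    (hD : IsDefectGroup p M P e) {n : H} (hnP : n ∈ Subgroup.normalizer (P : Set H))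
    (hnM : n ∈ Subgroup.normalizer (M : Set H)) :
    conj O n e = e ↔
      conj (IsLocalRing.ResidueField O) n (brauerMap O P e) = brauerMap O P e := by
  constructor
  · intro h
    rw [← brauerMap_conj hnP, h]
  · intro h
    -- Were the block orthogonal to its conjugate, applying $\mathrm{Br}_P$ would give
    -- $\mathrm{Br}_P(e)^2=0$ for an idempotent $\mathrm{Br}_P(e)\ne0$.
    refine ((he.eq_of_mul_ne_zero (he.conj hnM)) fun h0 => hD.brauer_ne_zero ?_).symm
    have h1 := congrArg (brauerMap O P) h0
    rw [brauerMap_mul hD.isPGroup (he.fixedBy.mono hD.le) ((he.conj hnM).fixedBy.mono hD.le),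
      brauerMap_conj hnP, h, ← brauerMap_mul hD.isPGroup (he.fixedBy.mono hD.le)
        (he.fixedBy.mono hD.le), he.idem, map_zero] at h1
    exact h1

omit [Finite H] in
theorem mem_normalizer_normIn [K.Normal] {n : H} (hn : n ∈ Subgroup.normalizer (P : Set H)) :
    n ∈ Subgroup.normalizer (normIn K P : Set H) := by
  rw [Subgroup.mem_normalizer_iff]
  intro h
  have h1 := Subgroup.mem_normalizer_iff.mp
    (Subgroup.le_normalizer (H := Subgroup.normalizer (P : Set H)) hn) h
  have h2 := Subgroup.mem_normalizer_iff.mp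
    ((Subgroup.normalizer_eq_top_iff.mpr ‹K.Normal›).symm ▸ Subgroup.mem_top n) h
  exact and_congr h1 h2

omit [Finite H] in
theorem stab_eq_stab_of_conj {R R' : Type*} [CommRing R] [CommRing R'] {L : Subgroup H}
    {e : MonoidAlgebra R H} {e' : MonoidAlgebra R' H}
    (h : ∀ n ∈ L, conj R n e = e ↔ conj R' n e' = e') : stab L e = stab L e' := by
  ext n
  exact and_congr_right (h n)

/-- If `C_σ C_{σ⁻¹} = C_1` and `σ` contains an element which stabilizes the `K`-fixed element `b`,
then `σ` contains such an element of `L`. -/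
theorem mem_map_stab_of_comp_mul_comp_inv [K.Normal] {R R' : Type*} [CommRing R] [CommRing R']
    (D : Datum R K) [IsLocalRing D.algOne] (h0 : D.e ≠ 0) {b : MonoidAlgebra R' H}
    (hb : FixedBy K b) {σ : H ⧸ K} (hσ : D.comp σ * D.comp σ⁻¹ = D.comp 1)
    (h : σ ∈ (stab ⊤ b).map (QuotientGroup.mk' K)) :
    σ ∈ (stab D.L b).map (QuotientGroup.mk' K) := by
  obtain ⟨x, hx, y, -, hxy⟩ := D.exists_mul_eq_e hσ
  -- Any group element in the support of $x$ lies in $L\cap\sigma$. It differs from the given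
  -- stabilizing element by a factor in $K$, which fixes $b$.
  obtain ⟨c, hc⟩ : ∃ c, x.coeff c ≠ 0 := by
    by_contra hcon
    push Not at hcon
    refine h0 ?_
    have hx0 : x = 0 := by
      ext c
      exact hcon c
    rw [← hxy, hx0, zero_mul]
  obtain ⟨h1, h2⟩ := (D.mem_comp.mp hx).1 c hc
  obtain ⟨g, hg, rfl⟩ := h
  refine ⟨c, ⟨h1, ?_⟩, h2⟩
  have h3 : g⁻¹ * c ∈ K := QuotientGroup.eq.mp h2.symm
  have h4 := conj_mul_of_fixedBy hb g h3
  rw [mul_inv_cancel_left] at h4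
  rw [h4]
  exact hg.2

end Stabilizers

end BlockClifford

end

/-! ### The main theorem -/

theorem mainTheorem4 {p : ℕ} [Fact p.Prime]
    {O : Type*} [CommRing O] [IsDomain O] [IsPrincipalIdealRing O] [IsLocalRing O]
    [CharP (IsLocalRing.ResidueField O) p]
    {H : Type*} [Group H] [Finite H] (K : Subgroup H) [K.Normal] (P : Subgroup H)
    (b b₁ : MonoidAlgebra O H) (hb : BlockClifford.IsBlock K b)
    (hP : BlockClifford.IsDefectGroup p K P b)
    (hb₁ : BlockClifford.IsBrauerCorrespondent p K P b b₁)
    (hO : IsAdicComplete (IsLocalRing.maximalIdeal O) O ∨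
      IsLocalRing (BlockClifford.blockDatum (K := K) ⊤ K (top_inf_eq K) b hb).algOne) :
    let CP : Subgroup H := Subgroup.centralizer (P : Set H)
    let NP : Subgroup H := Subgroup.normalizer (P : Set H)
    let NKP : Subgroup H := BlockClifford.normIn K P
    let bbar := BlockClifford.brauerMap O P b
    -- the data of `b` in `OH`, of `b₁` in `ON_H(P)` and of `b̄` in `kC_H(P)`
    let D₁ : BlockClifford.Datum O K := BlockClifford.blockDatum ⊤ K (top_inf_eq K) b hb
    let D₂ : BlockClifford.Datum O K := BlockClifford.blockDatum NP NKP rfl b₁ hb₁.isBlock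
    let D₃ : BlockClifford.Datum (IsLocalRing.ResidueField O) K :=
      BlockClifford.brauerDatum K P b hb hP
    -- `N_H(P)_b = N_H(P)_{b₁} = N_H(P)_{b̄}`
    BlockClifford.stab NP b = BlockClifford.stab NP b₁ ∧
    BlockClifford.stab NP b = BlockClifford.stab NP bbar ∧
    -- `G[b] = G[b₁]`, and both are equal to the group of the extension of `b̄` in `kC_H(P)`
    D₁.group = D₂.group ∧
    D₁.group = D₃.group ∧
    -- `G[b] = G[b̄]`, indexed by `G_b`, by `N_H(P)_b K/K` and by `C_H(P)_b K/K`
    (D₁.group : Set (H ⧸ K)) =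
      BlockClifford.cliffordSet K (BlockClifford.stab ⊤ b) CP NKP bbar ∧
    (D₁.group : Set (H ⧸ K)) =
      BlockClifford.cliffordSet K (BlockClifford.stab NP b) CP NKP bbar ∧
    (D₁.group : Set (H ⧸ K)) =
      BlockClifford.cliffordSet K (BlockClifford.stab CP b) CP NKP bbar ∧
    -- the three Clifford extensions exist and are isomorphic, compatibly with `N_H(P)_b`
    ∃ (S₁ : GroupExtension D₁.BarOneˣ D₁.hU D₁.group)
      (S₂ : GroupExtension D₂.BarOneˣ D₂.hU D₂.group)
      (S₃ : GroupExtension D₃.BarOneˣ D₃.hU D₃.group),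
      D₁.IsCliffordExtension S₁ ∧ D₂.IsCliffordExtension S₂ ∧ D₃.IsCliffordExtension S₃ ∧
      BlockClifford.Datum.ExtensionIso (RingHom.id O) (BlockClifford.stab NP b) D₁ D₂ S₁ S₂ ∧
      BlockClifford.Datum.ExtensionIso (IsLocalRing.residue O) (BlockClifford.stab NP b)
        D₁ D₃ S₁ S₃ ∧
      BlockClifford.Datum.ExtensionIso (IsLocalRing.residue O) (BlockClifford.stab NP b)
        D₂ D₃ S₂ S₃ := by
  intro CP NP NKP bbar D₁ D₂ D₃
  have h13 : BlockClifford.Datum.IsGradedMap (IsLocalRing.residue O) D₁ D₃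
      (BlockClifford.brauerMap O P) :=
    BlockClifford.isGradedMap_brauerMap hb hP (top_inf_eq K) hb hP le_top inf_le_right rfl
  have h23 : BlockClifford.Datum.IsGradedMap (IsLocalRing.residue O) D₂ D₃
      (BlockClifford.brauerMap O P) :=
    BlockClifford.isGradedMap_brauerMap hb hP rfl hb₁.isBlock hb₁.isDefectGroup
      (Subgroup.centralizer_le_normalizer _) le_rfl hb₁.brauer_eq
  have : IsLocalRing D₁.algOne := by
    rcases hO with hO | hO
    · exact BlockClifford.isLocalRing_algOne_of_isAdicComplete (top_inf_eq K) hb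
    · exact hO
  have : Nontrivial D₃.algOne := BlockClifford.Datum.nontrivial_algOne hP.brauer_ne_zero
  have : IsLocalRing D₃.algOne := h13.isLocalRing
  have : IsLocalRing D₂.algOne := BlockClifford.isLocalRing_algOne_of_isGradedMap hP.isPGroup
    hb₁.isBlock hb₁.isDefectGroup.le h23
  have hbbar : ∀ n ∈ NP, BlockClifford.conj O n b = b ↔
      BlockClifford.conj (IsLocalRing.ResidueField O) n bbar = bbar := fun n hn =>
    BlockClifford.conj_eq_self_iff_brauerMap hb hP hn
      ((Subgroup.normalizer_eq_top_iff.mpr ‹K.Normal›).symm ▸ Subgroup.mem_top n)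
  have hb₁bar : ∀ n ∈ NP, BlockClifford.conj O n b₁ = b₁ ↔
      BlockClifford.conj (IsLocalRing.ResidueField O) n bbar = bbar := fun n hn => by
    have h := BlockClifford.conj_eq_self_iff_brauerMap hb₁.isBlock hb₁.isDefectGroup hn
      (BlockClifford.mem_normalizer_normIn hn)
    rwa [hb₁.brauer_eq] at h
  have hCN : CP ≤ NP := Subgroup.centralizer_le_normalizer _
  have hstab₁ : BlockClifford.stab NP b = BlockClifford.stab NP b₁ :=
    BlockClifford.stab_eq_stab_of_conj fun n hn => (hbbar n hn).trans (hb₁bar n hn).symm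
  have hstab₂ : BlockClifford.stab NP b = BlockClifford.stab NP bbar :=
    BlockClifford.stab_eq_stab_of_conj hbbar
  have hstab₃ : BlockClifford.stab CP b = BlockClifford.stab CP bbar :=
    BlockClifford.stab_eq_stab_of_conj fun n hn => hbbar n (hCN hn)
  -- The index group is immaterial between $C_H(P)_b$ and $H_b$: the condition on $\sigma$ already
  -- forces a representative in $C_H(P)_b$.
  have hset : ∀ S : Subgroup H, BlockClifford.stab CP b ≤ S → S ≤ BlockClifford.stab ⊤ b →
      BlockClifford.cliffordSet K S CP NKP bbar =
        BlockClifford.cliffordSet K (BlockClifford.stab CP b) CP NKP bbar := by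
    intro S h1 h2
    ext σ
    exact ⟨fun h => ⟨BlockClifford.mem_map_stab_of_comp_mul_comp_inv D₃ hP.brauer_ne_zero
        hb.fixedBy h.2 (Subgroup.map_mono h2 h.1), h.2⟩,
      fun h => ⟨Subgroup.map_mono h1 h.1, h.2⟩⟩
  have hCN' : BlockClifford.stab CP b ≤ BlockClifford.stab NP b := fun n hn => ⟨hCN hn.1, hn.2⟩
  have hNT : BlockClifford.stab NP b ≤ BlockClifford.stab ⊤ b := fun n hn => ⟨trivial, hn.2⟩
  have hG₁ : (D₁.group : Set (H ⧸ K)) =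
      BlockClifford.cliffordSet K (BlockClifford.stab ⊤ b) CP NKP bbar := by
    ext σ
    exact and_congr_right fun _ => h13.comp_mul_comp_inv_iff σ
  have hG₂ : (D₂.group : Set (H ⧸ K)) =
      BlockClifford.cliffordSet K (BlockClifford.stab NP b) CP NKP bbar := by
    rw [hstab₁]
    ext σ
    exact and_congr_right fun _ => h23.comp_mul_comp_inv_iff σ
  have hG₃ : (D₃.group : Set (H ⧸ K)) =
      BlockClifford.cliffordSet K (BlockClifford.stab CP b) CP NKP bbar := by
    rw [hstab₃]
    rfl
  have h13' : D₁.group = D₃.group :=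
    SetLike.coe_injective (by rw [hG₁, hG₃, hset _ (hCN'.trans hNT) le_rfl])
  have h23' : D₂.group = D₃.group :=
    SetLike.coe_injective (by rw [hG₂, hG₃, hset _ hCN' hNT])
  have hN₁ : BlockClifford.stab NP b ≤ D₁.actGroup := fun n hn =>
    ⟨⟨Subgroup.le_normalizer (Subgroup.mem_top n),
      (Subgroup.normalizer_eq_top_iff.mpr ‹K.Normal›).symm ▸ Subgroup.mem_top n⟩, hn.2⟩
  have hN₂ : BlockClifford.stab NP b ≤ D₂.actGroup := fun n hn =>
    ⟨⟨Subgroup.le_normalizer hn.1, BlockClifford.mem_normalizer_normIn hn.1⟩,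
      (hstab₁ ▸ hn : n ∈ BlockClifford.stab NP b₁).2⟩
  have hN₃ : BlockClifford.stab NP b ≤ D₃.actGroup := fun n hn =>
    ⟨⟨BlockClifford.mem_normalizer_centralizer hn.1, BlockClifford.mem_normalizer_normIn hn.1⟩,
      (hstab₂ ▸ hn : n ∈ BlockClifford.stab NP bbar).2⟩
  have i13 := h13.isBarIso h13' hN₁ hN₃ fun n hn x _ => BlockClifford.brauerMap_conj hn.1 x
  have i23 := h23.isBarIso h23' hN₂ hN₃ fun n hn x _ => BlockClifford.brauerMap_conj hn.1 x
  refine ⟨hstab₁, hstab₂, h13'.trans h23'.symm, h13', hG₁, by rw [h13', hG₃, hset _ hCN' hNT],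
    by rw [h13', hG₃], D₁.cliffordExtension, D₂.cliffordExtension, D₃.cliffordExtension,
    D₁.isCliffordExtension, D₂.isCliffordExtension, D₃.isCliffordExtension, ?_,
    i13.extensionIso, i23.extensionIso⟩
  -- The composite $\bar C(b)\to\bar C(\bar b)\leftarrow\bar C(b_1)$ is $\mathcal O$-linear because
  -- $\mathcal O$ acts on the middle ring through the same residue map from either side.
  exact (i13.trans_symm (RingHom.comp_id _) i23).extensionIso
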